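/- **Darboux's theorem.** Let $n\ge 0$, let $M$ be a smooth manifold (without boundary) of dimension $2n+1$, and let $\alpha$ be a contact form on $M$, that is, a smooth $1$-form such that the $(2n+1)$-form $\alpha\wedge(d\alpha)^n$ vanishes at no point of $M$. Let $p\in M$. Then there are smooth local coordinates $x_1,\dots,x_n,y_1,\dots,y_n,z$ on an open neighbourhood $U\subset M$ of $p$ such that \[ \alpha|_U = dz+\sum_{j=1}^n x_j\,dy_j . \] -/

import Mathlib

open scoped Manifold ContDiff

noncomputable section

namespace ContactDarboux

/-! ### Exterior algebra of alternating forms on a real vector space -/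

section Linear

variable {V : Type*} [AddCommGroup V] [Module ℝ V]

/-- The exterior product of real-valued alternating forms, that is, the sum over shuffles
`(a ∧ b)(u₁, …, u_{k+l}) = ∑ sign(σ) a(u_{σ(1)}, …, u_{σ(k)}) b(u_{σ(k+1)}, …, u_{σ(k+l)})`. -/
def wedge {k l : ℕ} (a : V [⋀^Fin k]→ₗ[ℝ] ℝ) (b : V [⋀^Fin l]→ₗ[ℝ] ℝ) :
    V [⋀^Fin (k + l)]→ₗ[ℝ] ℝ :=
  ((LinearMap.mul' ℝ ℝ).compAlternatingMap (a.domCoprod b)).domDomCongr finSumFinEquiv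

/-- The `k`-th exterior power `b ∧ ⋯ ∧ b` of a `2`-form `b`; the `0`-th power is the constant `1`. -/
def wedgePow (b : V [⋀^Fin 2]→ₗ[ℝ] ℝ) : (k : ℕ) → V [⋀^Fin (2 * k)]→ₗ[ℝ] ℝ
  | 0 => AlternatingMap.constOfIsEmpty ℝ V (Fin 0) (1 : ℝ)
  | k + 1 => wedge (wedgePow b k) b

/-- A linear form, regarded as an alternating form of degree one. -/
def oneForm (a : V →ₗ[ℝ] ℝ) : V [⋀^Fin 1]→ₗ[ℝ] ℝ :=
  AlternatingMap.ofSubsingleton ℝ V ℝ (0 : Fin 1) a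

end Linear

/-! ### One-forms on manifolds without boundary -/

section Manifold

variable {E : Type*} [NormedAddCommGroup E] [NormedSpace ℝ E]
  {M : Type*} [TopologicalSpace M] [ChartedSpace E M]

/-- The `1`-form `α` read in the preferred chart `φ` at `x₀`, i.e. the pullback `(φ⁻¹)^* α`. -/
def inChart (α : ∀ x : M, TangentSpace 𝓘(ℝ, E) x →L[ℝ] ℝ) (x₀ : M) (y : E) : E →L[ℝ] ℝ :=
  (α ((extChartAt 𝓘(ℝ, E) x₀).symm y)).comp
    (mfderiv 𝓘(ℝ, E) 𝓘(ℝ, E) (extChartAt 𝓘(ℝ, E) x₀).symm y)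

/-- The exterior derivative `dα` of a `1`-form at the point `x`, computed in the preferred chart
`φ` at `x`: it is `φ^* d((φ⁻¹)^* α)`. -/
def mextDeriv (α : ∀ x : M, TangentSpace 𝓘(ℝ, E) x →L[ℝ] ℝ) (x : M) :
    TangentSpace 𝓘(ℝ, E) x [⋀^Fin 2]→L[ℝ] ℝ :=
  (extDeriv (fun y : E ↦ ContinuousAlternatingMap.ofSubsingleton ℝ E ℝ (0 : Fin 1) (inChart α x y))
    (extChartAt 𝓘(ℝ, E) x x)).compContinuousLinearMap
      (mfderiv 𝓘(ℝ, E) 𝓘(ℝ, E) (extChartAt 𝓘(ℝ, E) x) x)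

/-- `α` is a smooth section of the cotangent bundle. -/
def IsSmoothOneForm (α : ∀ x : M, TangentSpace 𝓘(ℝ, E) x →L[ℝ] ℝ)
    [IsManifold 𝓘(ℝ, E) ∞ M] : Prop :=
  ContMDiff 𝓘(ℝ, E) (𝓘(ℝ, E).prod 𝓘(ℝ, E →L[ℝ] ℝ)) ∞
    (fun x : M ↦ Bundle.TotalSpace.mk' (E →L[ℝ] ℝ)
      (E := fun x : M ↦ TangentSpace 𝓘(ℝ, E) x →L[ℝ] ℝ) x (α x))

end Manifold

/-- A contact form on a manifold of dimension `2n+1`: a smooth `1`-form `α` such that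
`α ∧ (dα)ⁿ` vanishes at no point. -/
structure IsContactForm (n : ℕ) {M : Type*} [TopologicalSpace M]
    [ChartedSpace (EuclideanSpace ℝ (Fin (2 * n + 1))) M] [IsManifold (𝓡 (2 * n + 1)) ∞ M]
    (α : ∀ x : M, TangentSpace (𝓡 (2 * n + 1)) x →L[ℝ] ℝ) : Prop where
  smooth : IsSmoothOneForm α
  wedge_ne_zero : ∀ x : M,
    wedge (oneForm (α x).toLinearMap) (wedgePow (mextDeriv α x).toAlternatingMap n) ≠ 0

/-- The position of the coordinate `x_j` in `(x₁, …, xₙ, y₁, …, yₙ, z)`. -/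
def xIdx {n : ℕ} (j : Fin n) : Fin (2 * n + 1) := ⟨j, by omega⟩

/-- The position of the coordinate `y_j` in `(x₁, …, xₙ, y₁, …, yₙ, z)`. -/
def yIdx {n : ℕ} (j : Fin n) : Fin (2 * n + 1) := ⟨n + j, by omega⟩

/-- The position of the coordinate `z` in `(x₁, …, xₙ, y₁, …, yₙ, z)`. -/
def zIdx (n : ℕ) : Fin (2 * n + 1) := ⟨2 * n, by omega⟩

end ContactDarboux

end

/-! The normal form is obtained by induction on n, alternating between odd and even dimension. Both
reductions rest on `exists_flowBox`. If α(X) = k and ι_X dα = cα with k, c constant, then Cartan's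
formula gives L_X α = cα. So in flow coordinates (t, π) issuing from a slice p + F transverse to X,
α = k dt + e^{ct} π^*(α|_{p+F}).

A contact form in dimension 2n+1 has its Reeb field, with k = 1 and c = 0. Hence α = dt + π^*β,
where dβ is symplectic on a slice of dimension 2n. A form β in dimension 2n+2 with dβ symplectic and
β(p) ≠ 0 has its Liouville field, ι_Y dβ = β, with k = 0 and c = 1. Hence β = e^t π^*λ with λ
contact on a slice of dimension 2n+1, and λ = dz + ∑ xⱼ dyⱼ turns into β = e^t dz + ∑ (e^t xⱼ) dyⱼ.
These steps are `SymplecticNormalForm.hasDarbouxForm` and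
`SymplecticNormalForm.hasDarbouxForm_succ`.

The functions found are coordinates: a vector killed by all dxⱼ, dyⱼ, dz is killed by α and by dα =
∑ dxⱼ ∧ dyⱼ, so it vanishes by the contact condition, and the inverse function theorem applies
(`exists_chart_of_normalForm`).

Smoothness of flows (`exists_smooth_flow`) comes from the inverse function theorem in ℝ × E ×
C([0,1], E), applied to the integral equation of γ' = ε X(γ). -/

noncomputable section

namespace ContactDarboux

open Filter Topology

universe u

/-! ### Smoothness near a point and the inverse function theorem -/

section Smooth

variable {E F G : Type*} [NormedAddCommGroup E] [NormedSpace ℝ E] [NormedAddCommGroup F]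
  [NormedSpace ℝ F] [NormedAddCommGroup G] [NormedSpace ℝ G]

/-- `f` is smooth on a neighbourhood of `p`. -/
def SmoothNear (f : E → F) (p : E) : Prop := ∀ᶠ q in 𝓝 p, ContDiffAt ℝ ∞ f q

theorem SmoothNear.contDiffAt {f : E → F} {p : E} (h : SmoothNear f p) : ContDiffAt ℝ ∞ f p :=
  h.self_of_nhds

theorem SmoothNear.differentiableAt {f : E → F} {p : E} (h : SmoothNear f p) :
    DifferentiableAt ℝ f p :=
  h.contDiffAt.differentiableAt (by simp)

theorem SmoothNear.continuousAt {f : E → F} {p : E} (h : SmoothNear f p) : ContinuousAt f p :=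
  h.contDiffAt.continuousAt

theorem SmoothNear.eventually {f : E → F} {p : E} (h : SmoothNear f p) :
    ∀ᶠ q in 𝓝 p, SmoothNear f q :=
  eventually_eventually_nhds.2 h

theorem _root_.ContDiff.smoothNear {f : E → F} (h : ContDiff ℝ ∞ f) (p : E) : SmoothNear f p :=
  .of_forall fun _ ↦ h.contDiffAt

theorem SmoothNear.comp {g : F → G} {f : E → F} {p : E} (hg : SmoothNear g (f p))
    (hf : SmoothNear f p) : SmoothNear (fun q ↦ g (f q)) p := by
  filter_upwards [hf, hf.continuousAt.eventually hg] with q h₁ h₂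
  exact h₂.comp q h₁

theorem SmoothNear.fderiv_right {f : E → F} {p : E} (h : SmoothNear f p) :
    SmoothNear (fderiv ℝ f) p := by
  filter_upwards [h] with q hq
  exact hq.fderiv_right (by simp)

/-- The smooth inverse function theorem, with smoothness on the whole source and target. -/
theorem SmoothNear.exists_openPartialHomeomorph [CompleteSpace E] {f : E → F} {p : E}
    (hf : SmoothNear f p) (A : E ≃L[ℝ] F) (hA : HasFDerivAt f (A : E →L[ℝ] F) p) :
    ∃ e : OpenPartialHomeomorph E F, p ∈ e.source ∧ (∀ x, e x = f x) ∧
      (∀ x ∈ e.source, ContDiffAt ℝ ∞ f x) ∧ ∀ y ∈ e.target, ContDiffAt ℝ ∞ e.symm y := by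
  let e₀ := hf.contDiffAt.toOpenPartialHomeomorph f hA (by simp)
  have he₀ : ∀ x, e₀ x = f x := fun x ↦ rfl
  have hp : p ∈ e₀.source := hf.contDiffAt.mem_toOpenPartialHomeomorph_source hA (by simp)
  -- Invertibility of the derivative is an open condition; restricting to where it holds makes the
  -- inverse smooth on its whole domain, not only at f(p).
  have hinv : ∀ᶠ x in 𝓝 p, ∃ B : E ≃L[ℝ] F, (B : E →L[ℝ] F) = fderiv ℝ f x := by
    have := hf.fderiv_right.continuousAt
    have h2 := this.eventually (p := fun L ↦ ∃ B : E ≃L[ℝ] F, (B : E →L[ℝ] F) = L)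
    apply h2
    rw [hA.fderiv]
    exact A.nhds
  obtain ⟨U, hU, hUo, hpU⟩ := eventually_nhds_iff.1 (hf.and hinv)
  refine ⟨e₀.restr U, by simp [hp, hpU, hUo.interior_eq], fun x ↦ rfl, fun x hx ↦ ?_, fun y hy ↦ ?_⟩
  · rw [e₀.restr_source, hUo.interior_eq] at hx
    exact (hU x hx.2).1
  · have hx := (e₀.restr U).map_target hy
    have hy0 : y ∈ e₀.target := (show y ∈ (e₀.restr U).target from hy).1
    rw [e₀.restr_source, hUo.interior_eq] at hx
    obtain ⟨h1, B, hB⟩ := hU _ hx.2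
    refine e₀.contDiffAt_symm (f₀' := B) hy0 ?_ h1
    rw [hB]
    exact (h1.differentiableAt (by simp)).hasFDerivAt

end Smooth

/-! ### Superposition operators on spaces of continuous maps -/

section Superposition

open ContinuousMap

variable {K : Type*} [TopologicalSpace K] [CompactSpace K]
  {E F : Type*} [NormedAddCommGroup E] [NormedSpace ℝ E] [NormedAddCommGroup F] [NormedSpace ℝ F]

/-- Pointwise evaluation of a continuous family of operators on a continuous map. -/
def pointwiseApply (K E F : Type*) [TopologicalSpace K] [CompactSpace K]
    [NormedAddCommGroup E] [NormedSpace ℝ E] [NormedAddCommGroup F] [NormedSpace ℝ F] :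
    C(K, E →L[ℝ] F) →L[ℝ] C(K, E) →L[ℝ] C(K, F) :=
  LinearMap.mkContinuous₂
    (LinearMap.mk₂ ℝ (fun (A : C(K, E →L[ℝ] F)) (h : C(K, E)) ↦
        (⟨fun t ↦ A t (h t), by fun_prop⟩ : C(K, F)))
      (fun _ _ _ ↦ by ext; simp) (fun _ _ _ ↦ by ext; simp)
      (fun _ _ _ ↦ by ext; simp) (fun _ _ _ ↦ by ext; simp))
    1 (fun A h ↦ by
      rw [one_mul]
      refine (ContinuousMap.norm_le _ (by positivity)).2 fun t ↦ ?_
      exact ((A t).le_opNorm _).trans (mul_le_mul (A.norm_coe_le_norm t) (h.norm_coe_le_norm t)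
        (norm_nonneg _) (by positivity)))

/-- The mean value inequality is applied at each t; continuity of δ ↦ f' ∘ δ in the sup norm makes
the estimate uniform in t. -/
theorem hasFDerivAt_comp_continuousMap {f : C(E, F)} {f' : C(E, E →L[ℝ] F)}
    (hf : ∀ x, HasFDerivAt f (f' x) x) (γ : C(K, E)) :
    HasFDerivAt (fun δ : C(K, E) ↦ f.comp δ) (pointwiseApply K E F (f'.comp γ)) γ := by
  rw [hasFDerivAt_iff_isLittleO_nhds_zero, Asymptotics.isLittleO_iff]
  intro ε hε
  have hc : ContinuousAt (fun δ : C(K, E) ↦ f'.comp δ) γ :=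
    (ContinuousMap.continuous_postcomp f').continuousAt
  obtain ⟨r, hr, hball⟩ := (Metric.continuousAt_iff (f := fun δ : C(K, E) ↦ f'.comp δ)).1 hc ε hε
  filter_upwards [Metric.ball_mem_nhds (0 : C(K, E)) hr] with h hh
  rw [mem_ball_zero_iff] at hh
  refine (ContinuousMap.norm_le _ (by positivity)).2 fun t ↦ ?_
  have key := (convex_ball (γ t) r).norm_image_sub_le_of_norm_hasFDerivWithin_le'
    (f := f) (f' := f') (φ := f' (γ t)) (C := ε) (fun x _ ↦ (hf x).hasFDerivWithinAt)
    (fun x hx ↦ ?_) (x := γ t) (y := γ t + h t) (Metric.mem_ball_self hr) ?_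
  · simp only [add_sub_cancel_left] at key
    exact key.trans (by gcongr; exact h.norm_coe_le_norm t)
  -- The translate of γ that passes through x at parameter t is a competitor within r of γ, so
  -- continuity of δ ↦ f' ∘ δ bounds f'(x) - f'(γ t).
  · have h1 : dist (γ + ContinuousMap.const K (x - γ t)) γ < r := by
      rw [dist_eq_norm, add_sub_cancel_left]
      refine lt_of_le_of_lt ((ContinuousMap.norm_le _ (norm_nonneg (x - γ t))).2 fun s ↦ le_rfl) ?_
      simpa [dist_eq_norm] using hx
    have h2 := (ContinuousMap.dist_apply_le_dist t).trans (hball h1).le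
    simpa [dist_eq_norm] using h2
  · simpa [dist_eq_norm] using (h.norm_coe_le_norm t).trans_lt hh

/-- The derivative of f ↦-composition is again composition, with f', followed by a continuous linear
map. The induction therefore changes the target to `E →L[ℝ] F`, which is why F is quantified inside
and shares the universe of E. -/
theorem contDiff_comp_continuousMap_nat {E : Type u} [NormedAddCommGroup E] [NormedSpace ℝ E]
    (m : ℕ) : ∀ {F : Type u} [NormedAddCommGroup F] [NormedSpace ℝ F] (f : C(E, F)),
    ContDiff ℝ ∞ f → ContDiff ℝ m (fun δ : C(K, E) ↦ f.comp δ) := by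
  induction m with
  | zero =>
    intro F _ _ f _
    exact contDiff_zero.2 (ContinuousMap.continuous_postcomp f)
  | succ m ih =>
    intro F _ _ f hf
    let f' : C(E, E →L[ℝ] F) := ⟨fderiv ℝ f, hf.continuous_fderiv (n := ∞) (by simp)⟩
    have hd := fun γ : C(K, E) ↦ hasFDerivAt_comp_continuousMap (f := f) (f' := f')
      (fun x ↦ (hf.differentiable (by simp) x).hasFDerivAt) γ
    refine contDiff_succ_iff_hasFDerivAt.2 ⟨_, ?_, hd⟩
    exact (pointwiseApply K E F).contDiff.comp (ih f' (hf.fderiv_right (by simp)))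

theorem contDiff_comp_continuousMap {E F : Type u} [NormedAddCommGroup E] [NormedSpace ℝ E]
    [NormedAddCommGroup F] [NormedSpace ℝ F] (f : C(E, F)) (hf : ContDiff ℝ ∞ f) :
    ContDiff ℝ ∞ (fun δ : C(K, E) ↦ f.comp δ) :=
  contDiff_infty.2 fun m ↦ contDiff_comp_continuousMap_nat m f hf

end Superposition

/-! ### Smooth dependence of the flow of a vector field on time and initial value -/

section Flow

open unitInterval

theorem continuous_comp_projIcc {E : Type u} [TopologicalSpace E] (γ : C(I, E)) :
    Continuous fun s : ℝ ↦ γ (Set.projIcc 0 1 zero_le_one s) :=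
  γ.continuous.comp continuous_projIcc

variable {E : Type u} [NormedAddCommGroup E] [NormedSpace ℝ E]

/-- The operator `γ ↦ (t ↦ ∫₀ᵗ γ)` on `C([0,1], E)`. -/
def primitive (E : Type u) [NormedAddCommGroup E] [NormedSpace ℝ E] : C(I, E) →L[ℝ] C(I, E) :=
  LinearMap.mkContinuous
    { toFun := fun γ ↦ ⟨fun t ↦ ∫ s in (0 : ℝ)..t, γ (Set.projIcc 0 1 zero_le_one s),
        (intervalIntegral.continuous_primitive
          (fun a b ↦ (continuous_comp_projIcc γ).intervalIntegrable a b) 0).comp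
          continuous_subtype_val⟩
      map_add' := fun γ δ ↦ by
        ext t
        exact intervalIntegral.integral_add ((continuous_comp_projIcc γ).intervalIntegrable _ _)
          ((continuous_comp_projIcc δ).intervalIntegrable _ _)
      map_smul' := fun c γ ↦ by
        ext t
        exact intervalIntegral.integral_smul c _ }
    1 (fun γ ↦ by
      refine (ContinuousMap.norm_le _ (by positivity)).2 fun t ↦ ?_
      refine (intervalIntegral.norm_integral_le_of_norm_le_const (C := ‖γ‖)
        fun s _ ↦ γ.norm_coe_le_norm _).trans ?_
      rw [sub_zero, abs_of_nonneg t.2.1, one_mul]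
      exact mul_le_of_le_one_right (norm_nonneg _) t.2.2)

theorem primitive_apply (γ : C(I, E)) (t : I) :
    primitive E γ t = ∫ s in (0 : ℝ)..t, γ (Set.projIcc 0 1 zero_le_one s) := rfl

/-- The curve `t ↦ γ (s t)`. -/
def rescale {E : Type u} [TopologicalSpace E] (s : I) (γ : C(I, E)) : C(I, E) :=
  γ.comp ⟨fun t ↦ s * t, by fun_prop⟩

@[simp]
theorem rescale_apply {E : Type u} [TopologicalSpace E] (s : I) (γ : C(I, E)) (t : I) :
    rescale s γ t = γ (s * t) := rfl

theorem primitive_rescale (s : I) (γ : C(I, E)) :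
    (s : ℝ) • primitive E (rescale s γ) = rescale s (primitive E γ) := by
  ext t
  simp only [ContinuousMap.smul_apply, rescale_apply, primitive_apply]
  have h := intervalIntegral.smul_integral_comp_mul_left (a := 0) (b := t)
    (fun x ↦ γ (Set.projIcc 0 1 zero_le_one x)) (s : ℝ)
  rw [mul_zero] at h
  rw [Set.Icc.coe_mul, ← h]
  congr 1
  refine intervalIntegral.integral_congr fun x hx ↦ ?_
  rw [Set.uIcc_of_le t.2.1] at hx
  have hx' : x ∈ Set.Icc (0 : ℝ) 1 := ⟨hx.1, hx.2.trans t.2.2⟩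
  have hsx : (s : ℝ) * x ∈ Set.Icc (0 : ℝ) 1 := (s * ⟨x, hx'⟩ : I).2
  simp only [Set.projIcc_of_mem zero_le_one hx', Set.projIcc_of_mem zero_le_one hsx]
  rfl

/-- The map whose zero fibres are the solutions of `γ' = ε X(γ)`, `γ 0 = x`. -/
def flowMap (X : C(E, E)) (w : (ℝ × E) × C(I, E)) : (ℝ × E) × C(I, E) :=
  (w.1, w.2 - ContinuousLinearMap.const ℝ I w.1.2 - w.1.1 • primitive E (X.comp w.2))

theorem contDiff_flowMap {X : C(E, E)} (hX : ContDiff ℝ ∞ X) : ContDiff ℝ ∞ (flowMap X) := by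
  have h1 : ContDiff ℝ ∞ fun w : (ℝ × E) × C(I, E) ↦ X.comp w.2 :=
    (contDiff_comp_continuousMap X hX).comp contDiff_snd
  have h2 : ContDiff ℝ ∞ fun w : (ℝ × E) × C(I, E) ↦ primitive E (X.comp w.2) :=
    (primitive E).contDiff.comp h1
  have h3 : ContDiff ℝ ∞ fun w : (ℝ × E) × C(I, E) ↦
      (ContinuousLinearMap.const ℝ I w.1.2 : C(I, E)) :=
    (ContinuousLinearMap.const ℝ I : E →L[ℝ] C(I, E)).contDiff.comp
      (contDiff_snd.comp contDiff_fst)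
  exact contDiff_fst.prodMk ((contDiff_snd.sub h3).sub ((contDiff_fst.comp contDiff_fst).smul h2))

/-- At ε = 0 the derivative of the nonlinear term in the direction of γ is multiplied by ε and
disappears. What remains is triangular with identity diagonal blocks. -/
theorem exists_hasFDerivAt_flowMap {X : C(E, E)} (hX : ContDiff ℝ ∞ X) (p : E) :
    ∃ A : ((ℝ × E) × C(I, E)) ≃L[ℝ] (ℝ × E) × C(I, E),
      HasFDerivAt (flowMap X) (A : ((ℝ × E) × C(I, E)) →L[ℝ] (ℝ × E) × C(I, E))
        ((0, p), ContinuousLinearMap.const ℝ I p) := by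
  set γ₀ : C(I, E) := ContinuousLinearMap.const ℝ I p
  let cst : E →L[ℝ] C(I, E) := ContinuousLinearMap.const ℝ I
  let L : (ℝ × E) →L[ℝ] C(I, E) := cst.comp (ContinuousLinearMap.snd ℝ ℝ E) +
    (ContinuousLinearMap.fst ℝ ℝ E).smulRight (primitive E (X.comp γ₀))
  refine ⟨ContinuousLinearEquiv.skewProd (.refl ℝ _) (.refl ℝ _) (-L), ?_⟩
  have h2 : DifferentiableAt ℝ (fun w : (ℝ × E) × C(I, E) ↦ primitive E (X.comp w.2))
      ((0, p), γ₀) :=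
    (((primitive E).contDiff.comp ((contDiff_comp_continuousMap X hX).comp
      contDiff_snd)).differentiable (n := ∞) (by simp)) _
  have h1 : HasFDerivAt (fun w : (ℝ × E) × C(I, E) ↦ w.1.1)
      ((ContinuousLinearMap.fst ℝ ℝ E).comp (ContinuousLinearMap.fst ℝ (ℝ × E) C(I, E)))
      ((0, p), γ₀) :=
    ((ContinuousLinearMap.fst ℝ ℝ E).comp (ContinuousLinearMap.fst ℝ (ℝ × E) C(I, E))).hasFDerivAt
  have h3 : HasFDerivAt (fun w : (ℝ × E) × C(I, E) ↦ cst w.1.2)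
      (cst.comp ((ContinuousLinearMap.snd ℝ ℝ E).comp
        (ContinuousLinearMap.fst ℝ (ℝ × E) C(I, E)))) ((0, p), γ₀) :=
    (cst.comp ((ContinuousLinearMap.snd ℝ ℝ E).comp
        (ContinuousLinearMap.fst ℝ (ℝ × E) C(I, E)))).hasFDerivAt
  have h := (hasFDerivAt_fst (𝕜 := ℝ) (p := (((0 : ℝ), p), γ₀))).prodMk
    ((hasFDerivAt_snd.sub h3).sub (h1.smul h2.hasFDerivAt))
  refine h.congr_fderiv ?_
  ext w <;> simp [L]

theorem flowMap_eq_iff {X : C(E, E)} {w : ℝ × E} {γ : C(I, E)} :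
    flowMap X (w, γ) = (w, 0) ↔
      γ = ContinuousLinearMap.const ℝ I w.2 + w.1 • primitive E (X.comp γ) := by
  rw [flowMap, Prod.mk.injEq, sub_sub, sub_eq_zero]
  simp

/-- Slowing time down by s turns a solution for ε into a solution for sε with the same initial
value. -/
theorem flowMap_rescale {X : C(E, E)} {w : ℝ × E} {γ : C(I, E)}
    (h : flowMap X (w, γ) = (w, 0)) (s : I) :
    flowMap X ((s * w.1, w.2), rescale s γ) = ((s * w.1, w.2), 0) := by
  rw [flowMap_eq_iff] at h ⊢
  have h1 : X.comp (rescale s γ) = rescale s (X.comp γ) := rfl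
  rw [h1, mul_comm, mul_smul, primitive_rescale]
  nth_rewrite 1 [h]
  rfl

theorem norm_rescale_sub_const_le (s : I) (γ : C(I, E)) (p : E) :
    ‖rescale s γ - ContinuousLinearMap.const ℝ I p‖ ≤ ‖γ - ContinuousLinearMap.const ℝ I p‖ :=
  (ContinuousMap.norm_le _ (norm_nonneg _)).2 fun t ↦
    (γ - ContinuousLinearMap.const ℝ I p).norm_coe_le_norm (s * t)

/-- The local flow of a smooth vector field is smooth in time and initial value. -/
theorem exists_smooth_flow [CompleteSpace E] {X : C(E, E)} (hX : ContDiff ℝ ∞ X) (p : E) :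
    ∃ Φ : ℝ × E → E, SmoothNear Φ (0, p) ∧
      (∀ᶠ w in 𝓝 ((0 : ℝ), p), HasDerivAt (fun τ ↦ Φ (τ, w.2)) (X (Φ w)) w.1) ∧
      ∀ᶠ x in 𝓝 p, Φ (0, x) = x := by
  set γ₀ : C(I, E) := ContinuousLinearMap.const ℝ I p with hγ₀
  obtain ⟨A, hA⟩ := exists_hasFDerivAt_flowMap hX p
  obtain ⟨e, hpe, hef, -, hesymm⟩ :=
    ((contDiff_flowMap hX).smoothNear _).exists_openPartialHomeomorph A hA
  have hbase : e ((0, p), γ₀) = ((0, p), 0) := by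
    rw [hef, flowMap_eq_iff]; simp [hγ₀]
  have hbase' : e.symm ((0, p), 0) = ((0, p), γ₀) := by rw [← hbase, e.left_inv hpe]
  let ι : ℝ × E → (ℝ × E) × C(I, E) := fun w ↦ (w, 0)
  have hι : ContDiff ℝ ∞ ι := contDiff_id.prodMk contDiff_const
  let Γ : ℝ × E → C(I, E) := fun w ↦ (e.symm (ι w)).2
  have htgt : ∀ᶠ w in 𝓝 ((0 : ℝ), p), ι w ∈ e.target := by
    refine hι.continuous.continuousAt.eventually (e.open_target.mem_nhds ?_)
    change ((0, p), (0 : C(I, E))) ∈ e.target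
    rw [← hbase]; exact e.map_source hpe
  have hΓ : ∀ᶠ w in 𝓝 ((0 : ℝ), p), ContDiffAt ℝ ∞ Γ w := by
    filter_upwards [htgt] with w hw
    exact contDiffAt_snd.comp w ((hesymm _ hw).comp w hι.contDiffAt)
  have hΓ0 : Γ (0, p) = γ₀ := congrArg Prod.snd hbase'
  obtain ⟨r, hr, hsrc⟩ := Metric.isOpen_iff.1 e.open_source _ hpe
  have hnear : ∀ᶠ w in 𝓝 ((0 : ℝ), p), ‖Γ w - γ₀‖ < r := by
    have := (hΓ.self_of_nhds.continuousAt).eventually (Metric.ball_mem_nhds _ hr)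
    rw [hΓ0] at this
    simpa [dist_eq_norm] using this
  obtain ⟨ρ, hρ, hall⟩ := Metric.eventually_nhds_iff_ball.1
    ((htgt.and hΓ).and (hnear.and (Metric.ball_mem_nhds ((0 : ℝ), p) hr)))
  have hfix : ∀ w ∈ Metric.ball ((0 : ℝ), p) ρ, flowMap X (w, Γ w) = (w, 0) := by
    intro w hw
    have h1 := e.right_inv (hall w hw).1.1
    rw [hef] at h1
    have h2 : (e.symm (ι w)).1 = w := congrArg Prod.fst h1
    have h3 : e.symm (ι w) = (w, Γ w) := Prod.ext h2 rfl
    rwa [h3] at h1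
  have hscale : ∀ w ∈ Metric.ball ((0 : ℝ), p) ρ, ∀ s : I,
      ((s * w.1, w.2) : ℝ × E) ∈ Metric.ball ((0 : ℝ), p) ρ := by
    intro w hw s
    simp only [Metric.mem_ball, Prod.dist_eq, max_lt_iff, dist_zero_right, norm_mul] at hw ⊢
    refine ⟨lt_of_le_of_lt ?_ hw.1, hw.2⟩
    refine mul_le_of_le_one_left (norm_nonneg _) ?_
    rw [Real.norm_of_nonneg s.2.1]; exact s.2.2
  -- Both curves solve the same equation and lie in the source of `e`, where `flowMap X` is
  -- injective.
  have hres : ∀ w ∈ Metric.ball ((0 : ℝ), p) ρ, ∀ s : I,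
      Γ (s * w.1, w.2) = rescale s (Γ w) := by
    intro w hw s
    have hw' := hscale w hw s
    have hmem : ∀ δ : C(I, E), ‖δ - γ₀‖ < r →
        (((s * w.1, w.2), δ) : (ℝ × E) × C(I, E)) ∈ e.source :=
      fun δ hδ ↦ hsrc (by
        rw [Metric.mem_ball, Prod.dist_eq, max_lt_iff, dist_eq_norm δ]
        exact ⟨(hall _ hw').2.2, hδ⟩)
    have hinj := e.injOn (hmem _ (hall _ hw').2.1)
      (hmem (rescale s (Γ w)) ((norm_rescale_sub_const_le s (Γ w) p).trans_lt (hall _ hw).2.1))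
      (by rw [hef, hef, hfix _ hw', flowMap_rescale (hfix _ hw)])
    exact congrArg Prod.snd hinj
  -- Flowing for time ε is flowing for time 1 along εX; by rescaling, the curve `Γ w` consists of
  -- the values of Φ at (s ε, x).
  let Φ : ℝ × E → E := fun w ↦ Γ w 1
  have hΦs : ∀ w ∈ Metric.ball ((0 : ℝ), p) ρ, ContDiffAt ℝ ∞ Φ w := fun w hw ↦
    (ContinuousMap.evalCLM ℝ (1 : I) : C(I, E) →L[ℝ] E).contDiff.contDiffAt.comp w (hall w hw).1.2
  have hΦint : ∀ w ∈ Metric.ball ((0 : ℝ), p) ρ,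
      Φ w = w.2 + ∫ τ in (0 : ℝ)..w.1, X (Φ (τ, w.2)) := by
    intro w hw
    have h1 : Φ w = w.2 + w.1 • primitive E (X.comp (Γ w)) 1 :=
      DFunLike.congr_fun (flowMap_eq_iff.1 (hfix w hw)) 1
    rw [h1, primitive_apply]
    congr 1
    have h2 := intervalIntegral.smul_integral_comp_mul_left (a := 0) (b := 1)
      (fun τ ↦ X (Φ (τ, w.2))) w.1
    rw [mul_zero, mul_one] at h2
    rw [← h2]
    congr 1
    refine intervalIntegral.integral_congr fun x hx ↦ ?_
    rw [Set.Icc.coe_one, Set.uIcc_of_le zero_le_one] at hx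
    have h3 := DFunLike.congr_fun (hres w hw ⟨x, hx⟩) 1
    rw [rescale_apply, mul_one] at h3
    simp only [ContinuousMap.comp_apply, Set.projIcc_of_mem zero_le_one hx, ← h3, mul_comm w.1 x, Φ]
  refine ⟨Φ, Filter.mem_of_superset (Metric.ball_mem_nhds _ hρ) hΦs, ?_, ?_⟩
  · filter_upwards [Metric.ball_mem_nhds _ hρ] with w hw
    have hw2 : dist w.2 p < ρ := (max_lt_iff.1 hw).2
    have hball : ∀ τ ∈ Metric.ball (0 : ℝ) ρ, ((τ, w.2) : ℝ × E) ∈ Metric.ball ((0 : ℝ), p) ρ :=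
      fun τ hτ ↦ max_lt hτ hw2
    have hcont : ContinuousOn (fun τ ↦ X (Φ (τ, w.2))) (Metric.ball (0 : ℝ) ρ) := fun τ hτ ↦
      (X.continuous.continuousAt.comp (f := fun τ ↦ Φ (τ, w.2))
        ((hΦs _ (hball τ hτ)).continuousAt.comp (f := fun τ ↦ (τ, w.2))
          (by fun_prop))).continuousWithinAt
    have hw1' : dist w.1 0 < ρ := (max_lt_iff.1 hw).1
    have hw1 : w.1 ∈ Metric.ball (0 : ℝ) ρ := hw1'
    have hd := intervalIntegral.integral_hasDerivAt_right (a := 0) (b := w.1)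
      (hcont.mono ?_).intervalIntegrable
      (hcont.stronglyMeasurableAtFilter Metric.isOpen_ball _ hw1)
      (hcont.continuousAt (Metric.isOpen_ball.mem_nhds hw1))
    · refine (hd.const_add w.2).congr_of_eventuallyEq ?_
      filter_upwards [Metric.isOpen_ball.mem_nhds hw1] with τ hτ
      exact hΦint _ (hball τ hτ)
    · exact (convex_ball (0 : ℝ) ρ).ordConnected.uIcc_subset (Metric.mem_ball_self hρ) hw1
  · filter_upwards [Metric.ball_mem_nhds p hρ] with x hx
    rw [hΦint (0, x) (by simpa [Prod.dist_eq, hρ] using hx)]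
    simp

end Flow

/-! ### Straightening a vector field that rescales a one-form -/

section FlowBox

variable {E F : Type u} [NormedAddCommGroup E] [NormedSpace ℝ E]
  [NormedAddCommGroup F] [NormedSpace ℝ F]

/-- A bump function globalizes a germ, since `exists_smooth_flow` requires a field smooth on all of
E. -/
theorem SmoothNear.exists_contDiff_eventuallyEq [FiniteDimensional ℝ E] {X : E → F} {p : E}
    (hX : SmoothNear X p) : ∃ Y : C(E, F), ContDiff ℝ ∞ Y ∧ Y =ᶠ[𝓝 p] X := by
  obtain ⟨r, hr, hball⟩ := Metric.eventually_nhds_iff_ball.1 hX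
  let b : ContDiffBump p := ⟨r / 4, r / 2, by positivity, by linarith⟩
  have hY : ContDiff ℝ ∞ fun q ↦ b q • X q := by
    refine contDiff_iff_contDiffAt.2 fun q ↦ ?_
    by_cases hq : q ∈ Metric.ball p r
    · exact b.contDiffAt.smul (hball q hq)
    · have hq' : q ∉ tsupport b := by
        rw [b.tsupport_eq]
        simp only [Metric.mem_ball, not_lt, Metric.mem_closedBall, not_le] at hq ⊢
        change r / 2 < dist q p
        linarith
      refine (contDiffAt_const (c := (0 : F))).congr_of_eventuallyEq ?_
      filter_upwards [notMem_tsupport_iff_eventuallyEq.1 hq'] with x hx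
      simp [hx]
  refine ⟨⟨fun q ↦ b q • X q, hY.continuous⟩, hY, ?_⟩
  filter_upwards [b.eventuallyEq_one] with q hq
  simp [hq]

/-- A smooth vector field has a smooth local flow. -/
theorem SmoothNear.exists_flow [FiniteDimensional ℝ E] {X : E → E} {p : E} (hX : SmoothNear X p) :
    ∃ Φ : ℝ × E → E, SmoothNear Φ (0, p) ∧
      (∀ᶠ w in 𝓝 ((0 : ℝ), p), fderiv ℝ Φ w (1, 0) = X (Φ w)) ∧
      ∀ᶠ x in 𝓝 p, Φ (0, x) = x := by
  have := FiniteDimensional.complete ℝ E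
  obtain ⟨Y, hY, hYX⟩ := hX.exists_contDiff_eventuallyEq
  obtain ⟨Φ, hΦ, hd, h0⟩ := exists_smooth_flow hY p
  refine ⟨Φ, hΦ, ?_, h0⟩
  have hlim : Tendsto Φ (𝓝 (0, p)) (𝓝 p) := by
    have := hΦ.continuousAt.tendsto
    rwa [h0.self_of_nhds] at this
  filter_upwards [hd, hΦ, hlim.eventually hYX] with w h1 h2 h3
  rw [← h3]
  have h4 : HasFDerivAt Φ (fderiv ℝ Φ w) (w.1, w.2) :=
    (h2.differentiableAt (by simp)).hasFDerivAt
  have h5 := h4.comp_hasDerivAt w.1 ((hasDerivAt_id w.1).prodMk (hasDerivAt_const w.1 w.2))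
  exact h5.unique h1

/-- The derivative of the pulled back form along the flow: if `α(X)` is constant and
`ι_X dα = c α`, then `α(∂Ψ/∂w)` satisfies `g' = c g`. -/
theorem hasDerivAt_pullback_of_flow {α : E → E →L[ℝ] ℝ} {X : E → E} {Ψ : ℝ × F → E} {k c : ℝ}
    {z : ℝ × F} (w : F) (hΨ : SmoothNear Ψ z) (hα : DifferentiableAt ℝ α (Ψ z))
    (hX : DifferentiableAt ℝ X (Ψ z)) (hk : ∀ᶠ q in 𝓝 (Ψ z), α q (X q) = k)
    (hc : ∀ v, fderiv ℝ α (Ψ z) (X (Ψ z)) v - fderiv ℝ α (Ψ z) v (X (Ψ z)) = c * α (Ψ z) v)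
    (hT : ∀ᶠ z' in 𝓝 z, fderiv ℝ Ψ z' (1, 0) = X (Ψ z')) :
    HasDerivAt (fun t ↦ α (Ψ (t, z.2)) (fderiv ℝ Ψ (t, z.2) (0, w)))
      (c * α (Ψ z) (fderiv ℝ Ψ z (0, w))) z.1 := by
  set ξ := fderiv ℝ Ψ z (0, w) with hξ
  have hd1 : HasFDerivAt Ψ (fderiv ℝ Ψ z) z := hΨ.differentiableAt.hasFDerivAt
  have hd2 : HasFDerivAt (fderiv ℝ Ψ) (fderiv ℝ (fderiv ℝ Ψ) z) z :=
    hΨ.fderiv_right.differentiableAt.hasFDerivAt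
  -- Symmetry of second derivatives, combined with differentiating ∂Ψ/∂t = X(Ψ) in the direction w.
  have hsymm : fderiv ℝ (fderiv ℝ Ψ) z (1, 0) (0, w) = fderiv ℝ X (Ψ z) ξ := by
    have h1 : IsSymmSndFDerivAt ℝ Ψ z := hΨ.contDiffAt.isSymmSndFDerivAt (by
      rw [minSmoothness_of_isRCLikeNormedField]
      exact WithTop.coe_le_coe.2 (le_top (a := (2 : ℕ∞))))
    rw [h1.eq]
    have h2 : HasFDerivAt (fun z' ↦ fderiv ℝ Ψ z' (1, 0))
        ((fderiv ℝ (fderiv ℝ Ψ) z).flip (1, 0)) z := by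
      simpa using hd2.clm_apply (hasFDerivAt_const ((1 : ℝ), (0 : F)) z)
    have h3 : HasFDerivAt (fun z' ↦ fderiv ℝ Ψ z' (1, 0))
        ((fderiv ℝ X (Ψ z)).comp (fderiv ℝ Ψ z)) z :=
      (hX.hasFDerivAt.comp z hd1).congr_of_eventuallyEq hT
    exact DFunLike.congr_fun (h2.unique h3) (0, w)
  -- Differentiating α(X) = k exchanges α(DX ξ) for -(Dα ξ)(X), so the product rule below yields
  -- dα(X, ξ) = c α(ξ).
  have hconst : fderiv ℝ α (Ψ z) ξ (X (Ψ z)) + α (Ψ z) (fderiv ℝ X (Ψ z) ξ) = 0 := by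
    have h1 := hα.hasFDerivAt.clm_apply hX.hasFDerivAt
    have h2 : HasFDerivAt (fun q ↦ α q (X q)) (0 : E →L[ℝ] ℝ) (Ψ z) :=
      (hasFDerivAt_const k (Ψ z)).congr_of_eventuallyEq hk
    have h3 := DFunLike.congr_fun (h1.unique h2) ξ
    simp only [add_apply, ContinuousLinearMap.comp_apply,
      ContinuousLinearMap.flip_apply, zero_apply] at h3
    linarith
  have hline : HasDerivAt (fun t : ℝ ↦ ((t, z.2) : ℝ × F)) (1, 0) z.1 :=
    (hasDerivAt_id z.1).prodMk (hasDerivAt_const z.1 z.2)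
  have hα' : HasDerivAt (fun t ↦ α (Ψ (t, z.2))) (fderiv ℝ α (Ψ z) (X (Ψ z))) z.1 := by
    have h1 := HasFDerivAt.comp_hasDerivAt z.1 (f := fun t : ℝ ↦ ((t, z.2) : ℝ × F))
      (hα.hasFDerivAt.comp z hd1) hline
    have h2 := hT.self_of_nhds
    rwa [ContinuousLinearMap.comp_apply, h2] at h1
  have hξ' : HasDerivAt (fun t ↦ fderiv ℝ Ψ (t, z.2) (0, w)) (fderiv ℝ X (Ψ z) ξ) z.1 := by
    have h1 := HasFDerivAt.comp_hasDerivAt z.1 (f := fun t : ℝ ↦ ((t, z.2) : ℝ × F)) hd2 hline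
    have h2 := h1.clm_apply (hasDerivAt_const z.1 ((0 : ℝ), w))
    simpa [hsymm] using h2
  have h := hα'.clm_apply hξ'
  refine h.congr_deriv ?_
  have := hc ξ
  simp only [Prod.mk.eta, ← hξ] at *
  linarith

theorem eq_exp_mul_of_hasDerivAt {g : ℝ → ℝ} {c r : ℝ}
    (hg : ∀ t ∈ Metric.ball (0 : ℝ) r, HasDerivAt g (c * g t) t) {t : ℝ}
    (ht : t ∈ Metric.ball (0 : ℝ) r) : g t = Real.exp (c * t) * g 0 := by
  have h0 : (0 : ℝ) ∈ Metric.ball (0 : ℝ) r :=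
    Metric.mem_ball_self (dist_nonneg.trans_lt (Metric.mem_ball.1 ht))
  have hd : ∀ s ∈ Metric.ball (0 : ℝ) r,
      HasDerivAt (fun s ↦ Real.exp (-(c * s)) * g s) 0 s := fun s hs ↦ by
    have h1 := ((((hasDerivAt_id s).const_mul c).neg).exp).mul (hg s hs)
    refine h1.congr_deriv ?_
    simp
    ring
  have h2 := Metric.isOpen_ball.is_const_of_deriv_eq_zero (convex_ball (0 : ℝ) r).isPreconnected
    (fun s hs ↦ (hd s hs).differentiableAt.differentiableWithinAt)
    (fun s hs ↦ (hd s hs).deriv) ht h0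
  simp only [mul_zero, neg_zero, Real.exp_zero, one_mul] at h2
  rw [← h2, ← mul_assoc, ← Real.exp_add]
  simp

/-- If `α(X) = k` and `ι_X dα = c α` near `p`, where `k` and `c` are constants, and `F` is
a complement of `X p`, then `α = k dt + e^{ct} π^*(α|_{p + F})` for suitable `t` and `π`. -/
theorem exists_flowBox [FiniteDimensional ℝ E] [FiniteDimensional ℝ F] {α : E → E →L[ℝ] ℝ}
    {X : E → E} {p : E} (hα : SmoothNear α p) (hX : SmoothNear X p) {k c : ℝ}
    (hk : ∀ᶠ q in 𝓝 p, α q (X q) = k)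
    (hc : ∀ᶠ q in 𝓝 p, ∀ v, fderiv ℝ α q (X q) v - fderiv ℝ α q v (X q) = c * α q v)
    (ι : F →L[ℝ] E) (A : (ℝ × F) ≃L[ℝ] E) (hA : ∀ s w, A (s, w) = s • X p + ι w) :
    ∃ (t : E → ℝ) (π : E → F), SmoothNear t p ∧ SmoothNear π p ∧ π p = 0 ∧
      ∀ᶠ q in 𝓝 p, ∀ v, α q v = k * fderiv ℝ t q v +
        Real.exp (c * t q) * α (p + ι (π q)) (ι (fderiv ℝ π q v)) := by
  have := FiniteDimensional.complete ℝ E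
  have := FiniteDimensional.complete ℝ F
  obtain ⟨Φ, hΦ, hΦT, hΦ0⟩ := hX.exists_flow
  let j : ℝ × F → ℝ × E := fun z ↦ (z.1, p + ι z.2)
  let j' : (ℝ × F) →L[ℝ] ℝ × E := (ContinuousLinearMap.id ℝ ℝ).prodMap ι
  have hj : ∀ z, HasFDerivAt j j' z := fun z ↦
    hasFDerivAt_fst.prodMk ((ι.hasFDerivAt.comp z hasFDerivAt_snd).const_add p)
  have hjs : ContDiff ℝ ∞ j :=
    contDiff_fst.prodMk (contDiff_const.add (ι.contDiff.comp contDiff_snd))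
  have hj0 : j 0 = (0, p) := by simp [j]
  have hjt : Tendsto j (𝓝 0) (𝓝 (0, p)) := hj0 ▸ hjs.continuous.continuousAt.tendsto
  -- The slice p + F is flowed out along X; t and π will be the components of the inverse of Ψ.
  let Ψ : ℝ × F → E := fun z ↦ Φ (j z)
  have hΨ : SmoothNear Ψ 0 := SmoothNear.comp (hj0 ▸ hΦ) (hjs.smoothNear 0)
  have hΨ' : ∀ᶠ z in 𝓝 (0 : ℝ × F), fderiv ℝ Ψ z = (fderiv ℝ Φ (j z)).comp j' := by
    filter_upwards [hjt.eventually hΦ] with z hz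
    exact ((hz.differentiableAt (by simp)).hasFDerivAt.comp z (hj z)).fderiv
  have hT : ∀ᶠ z in 𝓝 (0 : ℝ × F), fderiv ℝ Ψ z (1, 0) = X (Ψ z) := by
    filter_upwards [hΨ', hjt.eventually hΦT] with z h1 h2
    rw [h1, ContinuousLinearMap.comp_apply, ← h2]
    simp [j']
  have hι0 : ∀ᶠ y in 𝓝 (0 : F), Ψ (0, y) = p + ι y := by
    have : Tendsto (fun y ↦ p + ι y) (𝓝 (0 : F)) (𝓝 p) := by
      have : Continuous fun y ↦ p + ι y := by fun_prop
      simpa using this.tendsto 0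
    exact this.eventually hΦ0
  have hincl : Tendsto (fun y : F ↦ ((0 : ℝ), y)) (𝓝 0) (𝓝 0) :=
    (Continuous.prodMk_right (0 : ℝ)).tendsto (0 : F)
  have hW : ∀ᶠ y in 𝓝 (0 : F), ∀ w, fderiv ℝ Ψ (0, y) (0, w) = ι w := by
    filter_upwards [hι0.eventually_nhds, hincl.eventually hΨ] with y h1 h2 w
    have h3 : HasFDerivAt (fun y ↦ Ψ (0, y))
        ((fderiv ℝ Ψ (0, y)).comp (ContinuousLinearMap.inr ℝ ℝ F)) y :=
      (h2.differentiableAt (by simp)).hasFDerivAt.comp y (hasFDerivAt_prodMk_right 0 y)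
    have h4 : HasFDerivAt (fun y ↦ Ψ (0, y)) ι y :=
      (ι.hasFDerivAt.const_add p).congr_of_eventuallyEq h1
    exact DFunLike.congr_fun (h3.unique h4) w
  have hΨ0 : Ψ 0 = p := by simpa using! hι0.self_of_nhds
  have hΨt : Tendsto Ψ (𝓝 0) (𝓝 p) := by simpa [hΨ0] using hΨ.continuousAt.tendsto
  -- Transversality of F to X(p), encoded in A, is what makes Ψ a local diffeomorphism.
  have hDA : HasFDerivAt Ψ (A : (ℝ × F) →L[ℝ] E) 0 := by
    refine hΨ.differentiableAt.hasFDerivAt.congr_fderiv ?_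
    ext
    · have := hT.self_of_nhds
      rw [hΨ0] at this
      simpa [hA] using this
    · rename_i w
      simpa [hA] using! hW.self_of_nhds w
  have hpull : ∀ᶠ z in 𝓝 (0 : ℝ × F), ∀ s w, α (Ψ z) (fderiv ℝ Ψ z (s, w)) =
      k * s + Real.exp (c * z.1) * α (p + ι z.2) (ι w) := by
    obtain ⟨r, hr, hball⟩ := Metric.eventually_nhds_iff_ball.1
      ((hΨ.eventually.and hT.eventually_nhds).and ((hΨt.eventually hα).and
        ((hΨt.eventually hX).and ((hΨt.eventually hk.eventually_nhds).and (hΨt.eventually hc)))))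
    have hsnd : Tendsto Prod.snd (𝓝 (0 : ℝ × F)) (𝓝 (0 : F)) := continuous_snd.tendsto 0
    filter_upwards [Metric.ball_mem_nhds _ hr, hsnd.eventually hW, hsnd.eventually hι0]
      with z hz hWz hιz s w
    have hz1 : dist z.1 0 < r := (max_lt_iff.1 hz).1
    have hz2 : dist z.2 0 < r := (max_lt_iff.1 hz).2
    have key := eq_exp_mul_of_hasDerivAt (c := c) (r := r)
      (g := fun t ↦ α (Ψ (t, z.2)) (fderiv ℝ Ψ (t, z.2) (0, w))) (fun t ht ↦ ?_) (t := z.1) hz1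
    · simp only [Prod.mk.eta, hWz, hιz] at key
      have hsw : ((s, w) : ℝ × F) = s • (1, 0) + (0, w) := by simp
      rw [hsw, map_add, map_smul, map_add, map_smul, key, (hball z hz).1.2.self_of_nhds,
        (hball z hz).2.2.2.1.self_of_nhds, smul_eq_mul, mul_comm s k]
    · obtain ⟨⟨h1, h2⟩, h3, h4, h5, h6⟩ := hball (t, z.2) (max_lt ht hz2)
      exact hasDerivAt_pullback_of_flow (z := (t, z.2)) w h1 (h3.differentiableAt (by simp))
        (h4.differentiableAt (by simp)) h5 h6 h2
  obtain ⟨e, he0, heΨ, hes, het⟩ := hΨ.exists_openPartialHomeomorph A hDA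
  have hptgt : p ∈ e.target := by rw [← hΨ0, ← heΨ]; exact e.map_source he0
  have hesymm : SmoothNear e.symm p := by
    filter_upwards [e.open_target.mem_nhds hptgt] with q hq using het q hq
  have hp0 : e.symm p = 0 := by rw [← hΨ0, ← heΨ, e.left_inv he0]
  have hst : Tendsto e.symm (𝓝 p) (𝓝 0) := hp0 ▸ hesymm.continuousAt.tendsto
  refine ⟨fun q ↦ (e.symm q).1, fun q ↦ (e.symm q).2,
    (contDiff_fst.smoothNear _).comp hesymm, (contDiff_snd.smoothNear _).comp hesymm,
    by simp [hp0], ?_⟩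
  filter_upwards [e.open_target.eventually_mem hptgt, hst.eventually hpull] with q hq hpq v
  have hd : HasFDerivAt e.symm (fderiv ℝ e.symm q) q :=
    ((het q hq).differentiableAt (by simp)).hasFDerivAt
  have hΨd : HasFDerivAt Ψ (fderiv ℝ Ψ (e.symm q)) (e.symm q) :=
    ((hes _ (e.map_target hq)).differentiableAt (by simp)).hasFDerivAt
  have hq' : Ψ (e.symm q) = q := by rw [← heΨ, e.right_inv hq]
  have hid : fderiv ℝ Ψ (e.symm q) (fderiv ℝ e.symm q v) = v := by
    have h1 : HasFDerivAt (fun x ↦ Ψ (e.symm x)) (ContinuousLinearMap.id ℝ E) q := by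
      refine (hasFDerivAt_id q).congr_of_eventuallyEq ?_
      filter_upwards [e.open_target.eventually_mem hq] with x hx
      rw [← heΨ, e.right_inv hx, id]
    exact DFunLike.congr_fun ((hΨd.comp q hd).unique h1) v
  have h := hpq (fderiv ℝ e.symm q v).1 (fderiv ℝ e.symm q v).2
  rw [Prod.mk.eta, hid, hq'] at h
  have h1 : fderiv ℝ (fun q ↦ (e.symm q).1) q v = (fderiv ℝ e.symm q v).1 := by
    rw [hd.fst.fderiv]; rfl
  have h2 : fderiv ℝ (fun q ↦ (e.symm q).2) q v = (fderiv ℝ e.symm q v).2 := by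
    rw [hd.snd.fderiv]; rfl
  rw [h, h1, h2]

end FlowBox

/-! ### The local normal form of contact forms on a vector space -/

section Local

variable {E F : Type u} [NormedAddCommGroup E] [NormedSpace ℝ E]
  [NormedAddCommGroup F] [NormedSpace ℝ F]

/-- The exterior derivative of a one-form on a vector space, as a bilinear form. -/
def dform (α : E → E →L[ℝ] ℝ) (q : E) : E →L[ℝ] E →L[ℝ] ℝ :=
  fderiv ℝ α q - (fderiv ℝ α q).flip

theorem dform_apply (α : E → E →L[ℝ] ℝ) (q v w : E) :
    dform α q v w = fderiv ℝ α q v w - fderiv ℝ α q w v := rfl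

theorem dform_swap (α : E → E →L[ℝ] ℝ) (q v w : E) : dform α q v w = -dform α q w v := by
  simp [dform_apply]

theorem SmoothNear.dform {α : E → E →L[ℝ] ℝ} {p : E} (h : SmoothNear α p) :
    SmoothNear (dform α) p := by
  filter_upwards [h.fderiv_right] with q hq
  have hflip : IsBoundedLinearMap ℝ (ContinuousLinearMap.flip : (E →L[ℝ] E →L[ℝ] ℝ) → _) :=
    IsLinearMap.with_bound ⟨fun _ _ ↦ rfl, fun _ _ ↦ rfl⟩ 1
      fun f ↦ by rw [ContinuousLinearMap.opNorm_flip, one_mul]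
  have hflip' : ContDiff ℝ ∞ (ContinuousLinearMap.flip : (E →L[ℝ] E →L[ℝ] ℝ) → _) :=
    IsBoundedLinearMap.contDiff (F := E →L[ℝ] E →L[ℝ] ℝ) hflip
  exact hq.sub (hflip'.contDiffAt.comp q hq)

/-- Near `p`, the one-form `α` is `dz + ∑ xⱼ dyⱼ` for smooth functions `xⱼ`, `yⱼ`, `z`. -/
def HasDarbouxForm (n : ℕ) (α : E → E →L[ℝ] ℝ) (p : E) : Prop :=
  ∃ (x y : Fin n → E → ℝ) (z : E → ℝ), (∀ j, SmoothNear (x j) p) ∧ (∀ j, SmoothNear (y j) p) ∧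
    SmoothNear z p ∧
      ∀ᶠ q in 𝓝 p, ∀ v, α q v = fderiv ℝ z q v + ∑ j, x j q * fderiv ℝ (y j) q v

/-- A linear system with smooth coefficients that is regular at `p` has a smooth solution. -/
theorem exists_smooth_solution [FiniteDimensional ℝ E] {T : E → E →L[ℝ] E →L[ℝ] ℝ}
    {β : E → E →L[ℝ] ℝ} {p : E} (hT : SmoothNear T p) (hβ : SmoothNear β p)
    (hinj : ∀ v, T p v = 0 → v = 0) :
    ∃ X : E → E, SmoothNear X p ∧ ∀ᶠ q in 𝓝 p, T q (X q) = β q ∧ ∀ v, T q v = 0 → v = 0 := by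
  have := FiniteDimensional.complete ℝ E
  have hker : LinearMap.ker (T p : E →ₗ[ℝ] E →L[ℝ] ℝ) = ⊥ := LinearMap.ker_eq_bot'.2 hinj
  have hdim : Module.finrank ℝ E = Module.finrank ℝ (E →L[ℝ] ℝ) := by
    rw [← (LinearMap.toContinuousLinearMap (𝕜 := ℝ) (E := E) (F' := ℝ)).finrank_eq]
    exact (Subspace.dual_finrank_eq (K := ℝ) (V := E)).symm
  let A : E ≃L[ℝ] E →L[ℝ] ℝ := (LinearEquiv.ofInjectiveOfFinrankEq
    (T p : E →ₗ[ℝ] E →L[ℝ] ℝ) (LinearMap.ker_eq_bot.1 hker) hdim).toContinuousLinearEquiv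
  have hA : (A : E →L[ℝ] E →L[ℝ] ℝ) = T p := by ext v; rfl
  have hnhds : ∀ᶠ q in 𝓝 p, ∃ B : E ≃L[ℝ] E →L[ℝ] ℝ, (B : E →L[ℝ] E →L[ℝ] ℝ) = T q :=
    hT.continuousAt.eventually (p := fun L ↦ ∃ B : E ≃L[ℝ] E →L[ℝ] ℝ, (B : E →L[ℝ] _) = L)
      (hA ▸ A.nhds)
  -- `ContinuousLinearMap.inverse` is zero on non-invertible operators; near p it is the true
  -- inverse, and smooth.
  refine ⟨fun q ↦ (T q).inverse (β q), ?_, ?_⟩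
  · filter_upwards [hT, hβ, hnhds] with q h1 h2 ⟨B, hB⟩
    have h3 : ContDiffAt ℝ ∞ ContinuousLinearMap.inverse (T q) := hB ▸ contDiffAt_map_inverse B
    exact (h3.comp q h1).clm_apply h2
  · filter_upwards [hnhds] with q ⟨B, hB⟩
    rw [← hB]
    exact ⟨by simp, fun v hv ↦ by simpa using hv⟩

/-- A skew-symmetric form on a space of odd dimension is degenerate. -/
theorem exists_ne_zero_of_skew_of_odd [FiniteDimensional ℝ E] (B : E →L[ℝ] E →L[ℝ] ℝ)
    (hB : ∀ v w, B v w = -B w v) (hodd : Odd (Module.finrank ℝ E)) :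
    ∃ v ≠ 0, ∀ w, B v w = 0 := by
  let b := Module.finBasis ℝ E
  let M : Matrix (Fin (Module.finrank ℝ E)) (Fin (Module.finrank ℝ E)) ℝ :=
    Matrix.of fun i j ↦ B (b i) (b j)
  have hM : M.transpose = -M := by
    ext i j
    exact hB _ _
  have hdet : M.det = 0 := by
    have h := M.det_transpose
    rw [hM, Matrix.det_neg, Fintype.card_fin, hodd.neg_one_pow] at h
    linarith
  obtain ⟨c, hc, hcM⟩ := Matrix.exists_vecMul_eq_zero_iff.2 hdet
  refine ⟨∑ i, c i • b i, fun h ↦ hc ?_, fun w ↦ ?_⟩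
  · funext i
    exact Fintype.linearIndependent_iff.1 b.linearIndependent c h i
  · suffices h : (B (∑ i, c i • b i) : E →ₗ[ℝ] ℝ) = 0 from DFunLike.congr_fun h w
    refine b.ext fun j ↦ ?_
    have := congrFun hcM j
    simpa [Matrix.vecMul, dotProduct, M] using this

/-- The Reeb vector field of a contact form. -/
theorem exists_reeb [FiniteDimensional ℝ E] {α : E → E →L[ℝ] ℝ} {p : E}
    (hodd : Odd (Module.finrank ℝ E)) (hα : SmoothNear α p)
    (hnd : ∀ v, α p v = 0 → (∀ w, dform α p v w = 0) → v = 0) :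
    ∃ R : E → E, SmoothNear R p ∧
      ∀ᶠ q in 𝓝 p, α q (R q) = 1 ∧ ∀ v, dform α q (R q) v = 0 := by
  -- Adding α ⊗ α removes the degeneracy of dα, and T(R) = α characterizes the Reeb field.
  let T : E → E →L[ℝ] E →L[ℝ] ℝ := fun q ↦ dform α q + (α q).smulRight (α q)
  have hTa : ∀ q v w, T q v w = dform α q v w + α q v * α q w := fun q v w ↦ rfl
  have hT : SmoothNear T p := by
    filter_upwards [hα, hα.dform] with q h1 h2
    exact h2.add (h1.smulRight h1)
  obtain ⟨R, hR, hRe⟩ := exists_smooth_solution hT hα fun v hv ↦ by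
    have hself : dform α p v v = 0 := by simp [dform_apply]
    have h1 := hTa p v v
    rw [hv, hself] at h1
    have h2 : α p v = 0 := by simpa using h1.symm
    refine hnd v h2 fun w ↦ ?_
    have h3 := hTa p v w
    rw [hv, h2] at h3
    simpa using h3.symm
  refine ⟨R, hR, ?_⟩
  filter_upwards [hRe] with q ⟨hq, hinj⟩
  -- For K in the kernel of dα, T(K) = α(K) α; hence R = K / α(K).
  obtain ⟨K, hK, hKd⟩ := exists_ne_zero_of_skew_of_odd (dform α q) (dform_swap α q) hodd
  have hαK : α q K ≠ 0 := fun h0 ↦ hK (hinj K (by ext w; simp [hTa, hKd, h0]))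
  have hRK : R q = (α q K)⁻¹ • K := by
    rw [← sub_eq_zero]
    refine hinj _ ?_
    rw [map_sub, hq]
    ext w
    simp [hTa, hKd, hαK]
  rw [hRK]
  exact ⟨by simp [hαK], fun v ↦ by simp [hKd]⟩

theorem exists_complement [FiniteDimensional ℝ E] (l : E →ₗ[ℝ] ℝ) {X : E} (hX : l X ≠ 0) :
    ∃ A : (ℝ × LinearMap.ker l) ≃L[ℝ] E, ∀ s w, A (s, w) = s • X + (w : E) := by
  let A₀ : (ℝ × LinearMap.ker l) →ₗ[ℝ] E :=
    (LinearMap.toSpanSingleton ℝ E X).coprod (LinearMap.ker l).subtype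
  have hA₀ : ∀ s w, A₀ (s, w) = s • X + (w : E) := fun s w ↦ by simp [A₀]
  refine ⟨(LinearEquiv.ofBijective A₀ ⟨?_, fun v ↦ ?_⟩).toContinuousLinearEquiv, hA₀⟩
  · rw [← LinearMap.ker_eq_bot, LinearMap.ker_eq_bot']
    rintro ⟨s, w⟩ h
    rw [hA₀] at h
    have h1 := congrArg l h
    rw [map_add, map_smul, w.2, add_zero, map_zero, smul_eq_mul] at h1
    obtain rfl : s = 0 := (mul_eq_zero.1 h1).resolve_right hX
    rw [zero_smul, zero_add] at h
    simpa using h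
  · refine ⟨(l v / l X, ⟨v - (l v / l X) • X, ?_⟩), ?_⟩
    · simp [hX]
    · rw [hA₀]; simp

theorem hasFDerivAt_restrict {α : E → E →L[ℝ] ℝ} {p : E} (hα : SmoothNear α p) (ι : F →L[ℝ] E) :
    HasFDerivAt (fun y ↦ (α (p + ι y)).comp ι)
      ((((ContinuousLinearMap.compL ℝ F E ℝ).flip ι).comp (fderiv ℝ α p)).comp ι) 0 := by
  have h1 : HasFDerivAt (fun y ↦ p + ι y) ι 0 := ι.hasFDerivAt.const_add p
  have h2 : HasFDerivAt α (fderiv ℝ α p) (p + ι 0) := by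
    rw [map_zero, add_zero]; exact hα.differentiableAt.hasFDerivAt
  exact ((ContinuousLinearMap.compL ℝ F E ℝ).flip ι).hasFDerivAt.comp 0 (h2.comp 0 h1)

/-- Exterior differentiation commutes with pullback to the slice; this carries nondegeneracy over to
the slice. -/
theorem dform_restrict {α : E → E →L[ℝ] ℝ} {p : E} (hα : SmoothNear α p) (ι : F →L[ℝ] E)
    (v w : F) : dform (fun y ↦ (α (p + ι y)).comp ι) 0 v w = dform α p (ι v) (ι w) := by
  rw [dform_apply, (hasFDerivAt_restrict hα ι).fderiv]
  rfl

theorem SmoothNear.restrict {α : E → E →L[ℝ] ℝ} {p : E} (hα : SmoothNear α p) (ι : F →L[ℝ] E) :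
    SmoothNear (fun y ↦ (α (p + ι y)).comp ι) 0 := by
  have h1 : SmoothNear (fun y : F ↦ p + ι y) 0 := (contDiff_const.add ι.contDiff).smoothNear 0
  exact (((ContinuousLinearMap.compL ℝ F E ℝ).flip ι).contDiff.smoothNear _).comp
    (SmoothNear.comp (by simpa using hα) h1)

/-- The normal form of one-forms with symplectic differential in dimension `2n`. -/
def SymplecticNormalForm (n : ℕ) : Prop :=
  ∀ (F : Type u) [NormedAddCommGroup F] [NormedSpace ℝ F] [FiniteDimensional ℝ F]
    (β : F → F →L[ℝ] ℝ) (p : F), Module.finrank ℝ F = 2 * n → SmoothNear β p →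
    (∀ v, (∀ w, dform β p v w = 0) → v = 0) → HasDarbouxForm n β p

/-- Contact forms in dimension `2n+1` are reduced to dimension `2n` along the Reeb field. -/
theorem SymplecticNormalForm.hasDarbouxForm {n : ℕ} (hn : SymplecticNormalForm.{u} n)
    [FiniteDimensional ℝ E] {α : E → E →L[ℝ] ℝ} {p : E}
    (hdim : Module.finrank ℝ E = 2 * n + 1) (hα : SmoothNear α p)
    (hnd : ∀ v, α p v = 0 → (∀ w, dform α p v w = 0) → v = 0) : HasDarbouxForm n α p := by
  obtain ⟨R, hR, hRe⟩ := exists_reeb (hdim ▸ odd_two_mul_add_one n) hα hnd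
  have hRp : α p (R p) = 1 := hRe.self_of_nhds.1
  let H := LinearMap.ker (α p : E →ₗ[ℝ] ℝ)
  obtain ⟨(A : (ℝ × H) ≃L[ℝ] E), hA⟩ := exists_complement (α p : E →ₗ[ℝ] ℝ) (X := R p)
    (by rw [ContinuousLinearMap.coe_coe, hRp]; exact one_ne_zero)
  obtain ⟨t, π, ht, hπ, hπ0, heq⟩ := exists_flowBox (k := 1) (c := 0) hα hR
    (hRe.mono fun q h ↦ h.1) (hRe.mono fun q h v ↦ by rw [← dform_apply, h.2, zero_mul])
    H.subtypeL A hA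
  have hHdim : Module.finrank ℝ H = 2 * n := by
    have := A.toLinearEquiv.finrank_eq
    rw [Module.finrank_prod, Module.finrank_self, hdim] at this
    omega
  obtain ⟨x, y, z, hx, hy, hz, hxyz⟩ := hn H _ 0 hHdim (hα.restrict H.subtypeL) fun v hv ↦ by
    have hv0 : α p (v : E) = 0 := v.2
    refine Subtype.ext (hnd v hv0 fun w ↦ ?_)
    obtain ⟨⟨s, w'⟩, rfl⟩ := A.surjective w
    have h1 := hv w'
    rw [dform_restrict hα] at h1
    -- Since E = ℝR ⊕ H and ι_R dα = 0, testing against H is enough.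
    rw [hA, map_add, map_smul, dform_swap, hRe.self_of_nhds.2]
    simpa using h1
  have hπt : Tendsto π (𝓝 p) (𝓝 0) := hπ0 ▸ hπ.continuousAt.tendsto
  have hzπ : SmoothNear (fun q ↦ z (π q)) p := SmoothNear.comp (hπ0 ▸ hz) hπ
  refine ⟨fun j q ↦ x j (π q), fun j q ↦ y j (π q), fun q ↦ t q + z (π q),
    fun j ↦ SmoothNear.comp (hπ0 ▸ hx j) hπ, fun j ↦ SmoothNear.comp (hπ0 ▸ hy j) hπ, ?_, ?_⟩
  · filter_upwards [ht, hzπ] with q h1 h2 using h1.add h2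
  · filter_upwards [heq, hπt.eventually hxyz, ht, hπ, hπt.eventually hz,
      hπt.eventually (eventually_all.2 hy)] with q h1 h2 h3 h4 h5 h6 v
    have hd := (h4.differentiableAt (by simp)).hasFDerivAt
    have hdz : HasFDerivAt (fun q ↦ t q + z (π q))
        (fderiv ℝ t q + (fderiv ℝ z (π q)).comp (fderiv ℝ π q)) q :=
      (h3.differentiableAt (by simp)).hasFDerivAt.add
        ((h5.differentiableAt (by simp)).hasFDerivAt.comp q hd)
    have hdy : ∀ j, fderiv ℝ (fun q ↦ y j (π q)) q v =
        fderiv ℝ (y j) (π q) (fderiv ℝ π q v) := fun j ↦ by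
      have : HasFDerivAt (fun q ↦ y j (π q)) _ q :=
        ((h6 j).differentiableAt (by simp)).hasFDerivAt.comp q hd
      rw [this.fderiv]; rfl
    have h7 := h2 (fderiv ℝ π q v)
    rw [ContinuousLinearMap.comp_apply] at h7
    rw [h1 v, h7, hdz.fderiv]
    simp [hdy, add_assoc]

/-- Forms with symplectic differential in dimension `2n+2` are reduced to contact forms in
dimension `2n+1` along the Liouville field. -/
theorem SymplecticNormalForm.hasDarbouxForm_succ {n : ℕ} (hn : SymplecticNormalForm.{u} n)
    [FiniteDimensional ℝ E] {β : E → E →L[ℝ] ℝ} {p : E}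
    (hdim : Module.finrank ℝ E = 2 * (n + 1)) (hβ : SmoothNear β p) (hβp : β p ≠ 0)
    (hnd : ∀ v, (∀ w, dform β p v w = 0) → v = 0) :
    ∃ (x y : Fin (n + 1) → E → ℝ), (∀ j, SmoothNear (x j) p) ∧ (∀ j, SmoothNear (y j) p) ∧
      ∀ᶠ q in 𝓝 p, ∀ v, β q v = ∑ j, x j q * fderiv ℝ (y j) q v := by
  obtain ⟨Y, hY, hYe'⟩ := exists_smooth_solution hβ.dform hβ
    fun v hv ↦ hnd v fun w ↦ by rw [hv]; rfl
  have hYe : ∀ᶠ q in 𝓝 p, dform β q (Y q) = β q := hYe'.mono fun q h ↦ h.1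
  have hYp : Y p ≠ 0 := fun h ↦ hβp (by rw [← hYe.self_of_nhds, h, map_zero])
  -- The kernel of β(p) cannot serve as the slice, because β(Y) = dβ(Y, Y) = 0; any hyperplane
  -- transverse to Y(p) will do.
  obtain ⟨l, hl⟩ := Module.Projective.exists_dual_ne_zero ℝ hYp
  let H := LinearMap.ker l
  obtain ⟨(A : (ℝ × H) ≃L[ℝ] E), hA⟩ := exists_complement l hl
  obtain ⟨t, π, ht, hπ, hπ0, heq⟩ := exists_flowBox (k := 0) (c := 1) hβ hY
    (hYe.mono fun q h ↦ by rw [← h]; simp [dform_apply])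
    (hYe.mono fun q h v ↦ by rw [← dform_apply, h, one_mul]) H.subtypeL A hA
  have hHdim : Module.finrank ℝ H = 2 * n + 1 := by
    have := A.toLinearEquiv.finrank_eq
    rw [Module.finrank_prod, Module.finrank_self, hdim] at this
    omega
  obtain ⟨x, y, z, hx, hy, hz, hxyz⟩ := hn.hasDarbouxForm hHdim (hβ.restrict H.subtypeL)
    fun v hv0 hv ↦ by
      have hv0' : β p (v : E) = 0 := by simpa using hv0
      refine Subtype.ext (hnd v fun w ↦ ?_)
      obtain ⟨⟨s, w'⟩, rfl⟩ := A.surjective w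
      have h1 := hv w'
      rw [dform_restrict hβ] at h1
      rw [hA, map_add, map_smul, dform_swap, hYe.self_of_nhds, hv0']
      simpa using h1
  have hπt : Tendsto π (𝓝 p) (𝓝 0) := hπ0 ▸ hπ.continuousAt.tendsto
  have hexp : SmoothNear (fun q ↦ Real.exp (t q)) p :=
    (Real.contDiff_exp.smoothNear _).comp ht
  have hxπ : ∀ j, SmoothNear (fun q ↦ x j (π q)) p := fun j ↦ SmoothNear.comp (hπ0 ▸ hx j) hπ
  -- The term e^t dz supplies the extra conjugate pair (e^t, z).
  refine ⟨Fin.cons (fun q ↦ Real.exp (t q)) fun j q ↦ Real.exp (t q) * x j (π q),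
    Fin.cons (fun q ↦ z (π q)) fun j q ↦ y j (π q), fun j ↦ ?_, fun j ↦ ?_, ?_⟩
  · refine Fin.cases hexp (fun j ↦ ?_) j
    filter_upwards [hexp, hxπ j] with q h1 h2 using h1.mul h2
  · have hzπ : SmoothNear (fun q ↦ z (π q)) p := SmoothNear.comp (hπ0 ▸ hz) hπ
    have hyπ : ∀ j, SmoothNear (fun q ↦ y j (π q)) p := fun j ↦ SmoothNear.comp (hπ0 ▸ hy j) hπ
    exact Fin.cases hzπ hyπ j
  · filter_upwards [heq, hπt.eventually hxyz, hπ, hπt.eventually hz,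
      hπt.eventually (eventually_all.2 hy)] with q h1 h2 h4 h5 h6 v
    have hd := (h4.differentiableAt (by simp)).hasFDerivAt
    have hdf : ∀ f : H → ℝ, ContDiffAt ℝ ∞ f (π q) →
        fderiv ℝ (fun q ↦ f (π q)) q v = fderiv ℝ f (π q) (fderiv ℝ π q v) := fun f hf ↦ by
      have : HasFDerivAt (fun q ↦ f (π q)) _ q :=
        (hf.differentiableAt (by simp)).hasFDerivAt.comp q hd
      rw [this.fderiv]; rfl
    have h7 := h2 (fderiv ℝ π q v)
    rw [ContinuousLinearMap.comp_apply] at h7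
    rw [h1 v, h7, Fin.sum_univ_succ]
    simp only [Fin.cons_zero, Fin.cons_succ, hdf z h5, hdf _ (h6 _), zero_mul, zero_add, one_mul,
      mul_add, Finset.mul_sum, mul_assoc]

theorem symplecticNormalForm (n : ℕ) : SymplecticNormalForm.{u} n := by
  induction n with
  | zero =>
    intro F _ _ _ β p hdim _ _
    have : Subsingleton F := Module.finrank_zero_iff.1 hdim
    refine ⟨Fin.elim0, Fin.elim0, 0, Fin.rec0, Fin.rec0, contDiff_const.smoothNear p,
      .of_forall fun q v ↦ ?_⟩
    simp [Subsingleton.elim v 0]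
  | succ n ih =>
    intro F _ _ _ β p hdim hβ hnd
    -- Subtracting a constant form keeps dβ and makes the Liouville field nonzero at p. The linear
    -- function m then returns as z, being its own differential.
    obtain ⟨m, hm⟩ : ∃ m : F →L[ℝ] ℝ, β p - m ≠ 0 := by
      by_cases h : β p = 0
      · have : Nontrivial F := Module.nontrivial_of_finrank_pos (R := ℝ) (by omega)
        obtain ⟨v, hv⟩ := exists_ne (0 : F)
        obtain ⟨l, hl⟩ := Module.Projective.exists_dual_ne_zero ℝ hv
        refine ⟨LinearMap.toContinuousLinearMap l, fun h' ↦ hl ?_⟩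
        have := DFunLike.congr_fun h' v
        simpa [h] using this
      · exact ⟨0, by simpa using h⟩
    have hβm : SmoothNear (fun q ↦ β q - m) p := by
      filter_upwards [hβ] with q hq using hq.sub contDiffAt_const
    have hdm : dform (fun q ↦ β q - m) p = dform β p := by
      rw [dform, dform, fderiv_sub_const m]
    obtain ⟨x, y, hx, hy, hxy⟩ := ih.hasDarbouxForm_succ hdim hβm hm (by rwa [hdm])
    refine ⟨x, y, m, hx, hy, m.contDiff.smoothNear p, ?_⟩
    filter_upwards [hxy] with q hq v
    rw [← hq v]
    simp

/-- Every contact form on a vector space of dimension `2n+1` is locally `dz + ∑ xⱼ dyⱼ`. -/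
theorem hasDarbouxForm_of_contact [FiniteDimensional ℝ E] {n : ℕ} {α : E → E →L[ℝ] ℝ} {p : E}
    (hdim : Module.finrank ℝ E = 2 * n + 1) (hα : SmoothNear α p)
    (hnd : ∀ v, α p v = 0 → (∀ w, dform α p v w = 0) → v = 0) : HasDarbouxForm n α p :=
  (symplecticNormalForm n).hasDarbouxForm hdim hα hnd

end Local

/-! ### Nondegeneracy of contact forms -/

section Nondegenerate

variable {V : Type*} [AddCommGroup V] [Module ℝ V]

/-- If `v` annihilates `a` and `b`, then it annihilates `a ∧ b`. -/
theorem wedge_apply_eq_zero {k l : ℕ} {a : V [⋀^Fin k]→ₗ[ℝ] ℝ} {b : V [⋀^Fin l]→ₗ[ℝ] ℝ} {v : V}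
    (ha : ∀ (u : Fin k → V) i, u i = v → a u = 0) (hb : ∀ (u : Fin l → V) i, u i = v → b u = 0)
    (u : Fin (k + l) → V) (i : Fin (k + l)) (hu : u i = v) : wedge a b u = 0 := by
  rw [wedge, AlternatingMap.domDomCongr_apply, LinearMap.compAlternatingMap_apply,
    AlternatingMap.domCoprod_apply]
  rw [sum_apply, map_sum]
  refine Finset.sum_eq_zero fun σ _ ↦ ?_
  induction σ using Quotient.inductionOn' with | _ σ
  rw [AlternatingMap.domCoprod.summand_mk'']
  -- In each shuffle, v is an argument of either a or b.
  rcases hi : σ.symm (finSumFinEquiv.symm i) with j | j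
  · have hj : (u ∘ finSumFinEquiv) (σ (Sum.inl j)) = v := by
      rw [← hi]; simpa using hu
    have := ha (fun j ↦ (u ∘ finSumFinEquiv) (σ (Sum.inl j))) j hj
    simp [MultilinearMap.domCoprod_apply] at this ⊢
    simp [this]
  · have hj : (u ∘ finSumFinEquiv) (σ (Sum.inr j)) = v := by
      rw [← hi]; simpa using hu
    have := hb (fun j ↦ (u ∘ finSumFinEquiv) (σ (Sum.inr j))) j hj
    simp [MultilinearMap.domCoprod_apply] at this ⊢
    simp [this]

theorem wedgePow_apply_eq_zero {b : V [⋀^Fin 2]→ₗ[ℝ] ℝ} {v : V}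
    (hb : ∀ (u : Fin 2 → V) i, u i = v → b u = 0) (k : ℕ) :
    ∀ (u : Fin (2 * k) → V) i, u i = v → wedgePow b k u = 0 := by
  induction k with
  | zero => exact fun _ i ↦ i.elim0
  | succ k ih => exact fun u i hu ↦ wedge_apply_eq_zero ih hb u i hu

/-- A top form annihilated by a nonzero vector vanishes. -/
theorem eq_zero_of_annihilates {N : ℕ} [FiniteDimensional ℝ V] (hN : Module.finrank ℝ V = N)
    {f : V [⋀^Fin N]→ₗ[ℝ] ℝ} {v : V} (hv : v ≠ 0) (hf : ∀ (u : Fin N → V) i, u i = v → f u = 0) :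
    f = 0 := by
  have hli : LinearIndepOn ℝ id ({v} : Set V) :=
    LinearIndepOn.singleton (R := ℝ) (by simpa using hv)
  let b := Module.Basis.extend hli
  have : Fintype (hli.extend (Set.subset_univ _)) := FiniteDimensional.fintypeBasisIndex b
  refine b.ext_alternating fun s hs ↦ ?_
  have hcard : Fintype.card (Fin N) = Fintype.card (hli.extend (Set.subset_univ _)) := by
    rw [Fintype.card_fin, ← Module.finrank_eq_card_basis b, hN]
  -- An injective family of N vectors from a basis containing v must include v.
  obtain ⟨i, hi⟩ := ((Fintype.bijective_iff_injective_and_card s).2 ⟨hs, hcard⟩).2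
    ⟨v, hli.subset_extend _ rfl⟩
  rw [hf _ i (by rw [hi]; exact Module.Basis.extend_apply_self hli _)]
  rfl

/-- A nonzero such v would annihilate the top form a ∧ bⁿ. This is the form in which the contact
condition enters the local argument. -/
theorem eq_zero_of_wedge_ne_zero {n : ℕ} [FiniteDimensional ℝ V]
    (hdim : Module.finrank ℝ V = 2 * n + 1) {a : V →ₗ[ℝ] ℝ} {b : V [⋀^Fin 2]→ₗ[ℝ] ℝ}
    (hab : wedge (oneForm a) (wedgePow b n) ≠ 0) {v : V} (hav : a v = 0)
    (hbv : ∀ w, b ![v, w] = 0) : v = 0 := by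
  by_contra hv
  refine hab (eq_zero_of_annihilates (by omega) hv (wedge_apply_eq_zero ?_
    (wedgePow_apply_eq_zero ?_ n)))
  · intro u i hu
    rw [Subsingleton.elim i 0] at hu
    rw [oneForm, AlternatingMap.ofSubsingleton_apply_apply, hu, hav]
  · intro u i hu
    have h0 : ∀ w : V, b ![w, v] = 0 := fun w ↦ by
      have h := b.map_swap ![v, w] (i := 0) (j := 1) (by simp)
      rw [hbv, neg_zero] at h
      rw [← h]
      congr 1
      ext k
      fin_cases k <;> simp
    have hu' : u = ![u 0, u 1] := by ext k; fin_cases k <;> rfl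
    rw [hu']
    fin_cases i
    · rw [show u 0 = v from hu, hbv]
    · rw [show u 1 = v from hu, h0]

end Nondegenerate

/-! ### One-forms read in a chart -/

section Chart

variable {E : Type*} [NormedAddCommGroup E] [NormedSpace ℝ E]
  {M : Type*} [TopologicalSpace M] [ChartedSpace E M] [IsManifold 𝓘(ℝ, E) ∞ M]

/-- The tangent spaces at φ⁻¹(φ(q)) and at q both unfold to E; with all maps typed over E, the base
point can be replaced by `congrArg`. -/
theorem inChart_apply {M : Type*} [TopologicalSpace M] [ChartedSpace E M]
    (α : ∀ x : M, TangentSpace 𝓘(ℝ, E) x →L[ℝ] ℝ) {p q : M}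
    (hq : q ∈ (chartAt E p).source) (v : E) :
    inChart α p (extChartAt 𝓘(ℝ, E) p q) v = (α q : E →L[ℝ] ℝ)
      ((mfderiv 𝓘(ℝ, E) 𝓘(ℝ, E) (extChartAt 𝓘(ℝ, E) p).symm (extChartAt 𝓘(ℝ, E) p q) :
        E →L[ℝ] E) v) :=
  congrArg (fun x : M ↦ (α x : E →L[ℝ] ℝ)
      ((mfderiv 𝓘(ℝ, E) 𝓘(ℝ, E) (extChartAt 𝓘(ℝ, E) p).symm (extChartAt 𝓘(ℝ, E) p q) :
        E →L[ℝ] E) v))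
    ((extChartAt 𝓘(ℝ, E) p).left_inv (by rwa [extChartAt_source]))

theorem eq_inChart_comp (α : ∀ x : M, TangentSpace 𝓘(ℝ, E) x →L[ℝ] ℝ) {p q : M}
    (hq : q ∈ (chartAt E p).source) (v : TangentSpace 𝓘(ℝ, E) q) :
    α q v = inChart α p (extChartAt 𝓘(ℝ, E) p q)
      (mfderiv 𝓘(ℝ, E) 𝓘(ℝ, E) (extChartAt 𝓘(ℝ, E) p) q v) := by
  have : IsManifold 𝓘(ℝ, E) 1 M := .of_le (n := ∞) (by simp)
  have hq' : q ∈ (extChartAt 𝓘(ℝ, E) p).source := by rwa [extChartAt_source]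
  have h := mfderivWithin_extChartAt_symm_comp_mfderiv_extChartAt' (I := 𝓘(ℝ, E)) hq'
  rw [ModelWithCorners.range_eq_univ, mfderivWithin_univ] at h
  refine Eq.trans ?_ (inChart_apply α hq _).symm
  exact congrArg (α q) (DFunLike.congr_fun h v).symm

theorem inChart_self (α : ∀ x : M, TangentSpace 𝓘(ℝ, E) x →L[ℝ] ℝ) (p : M) (v : E) :
    inChart α p (extChartAt 𝓘(ℝ, E) p p) v = (α p : E →L[ℝ] ℝ) v := by
  have : IsManifold 𝓘(ℝ, E) 1 M := .of_le (n := ∞) (by simp)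
  have h := eq_inChart_comp α (mem_chart_source E p) v
  rw [mfderiv_extChartAt_self] at h
  exact h.symm

theorem IsSmoothOneForm.contDiffOn_inChart {α : ∀ x : M, TangentSpace 𝓘(ℝ, E) x →L[ℝ] ℝ}
    (hα : IsSmoothOneForm α) (p : M) :
    ContDiffOn ℝ ∞ (inChart α p) (extChartAt 𝓘(ℝ, E) p).target := by
  have : IsManifold 𝓘(ℝ, E) 1 M := .of_le (n := ∞) (by simp)
  have : IsManifold 𝓘(ℝ, E) (∞ + 1) M := by simpa
  have h1 : ContMDiffOn 𝓘(ℝ, E) 𝓘(ℝ, E →L[ℝ] ℝ) ∞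
      (fun x ↦ inChart α p (extChartAt 𝓘(ℝ, E) p x)) (chartAt E p).source := by
    have h2 := (Bundle.Trivialization.contMDiffOn_section_baseSet_iff (IB := 𝓘(ℝ, E)) (n := ∞)
      (s := α)
      (trivializationAt (E →L[ℝ] ℝ) (fun x : M ↦ TangentSpace 𝓘(ℝ, E) x →L[ℝ] ℝ) p)).1
      hα.contMDiffOn
    refine (h2.mono fun x hx ↦ ⟨hx, Set.mem_univ _⟩).congr fun x hx ↦ ?_
    ext v
    -- The inverse trivialization of the tangent bundle is the derivative of φ⁻¹, so the coordinate
    -- expression of α in the cotangent bundle is `inChart α p`.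
    have h3 := TangentBundle.symmL_trivializationAt (I := 𝓘(ℝ, E)) hx
    rw [ModelWithCorners.range_eq_univ, mfderivWithin_univ] at h3
    rw [inChart_apply α hx]
    refine (congrArg (α x) (DFunLike.congr_fun h3 v).symm).trans ?_
    have h4 := Bundle.Trivial.continuousLinearMapAt_trivialization ℝ M ℝ x
    exact (DFunLike.congr_fun h4 _).symm
  rw [← contMDiffOn_iff_contDiffOn]
  refine (h1.comp (contMDiffOn_extChartAt_symm p) fun y hy ↦ ?_).congr fun y hy ↦ ?_
  · rw [Set.mem_preimage, ← extChartAt_source 𝓘(ℝ, E)]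
    exact (extChartAt 𝓘(ℝ, E) p).map_target hy
  · rw [Function.comp_apply, (extChartAt 𝓘(ℝ, E) p).right_inv hy]

theorem mextDeriv_apply {α : ∀ x : M, TangentSpace 𝓘(ℝ, E) x →L[ℝ] ℝ} {p : M}
    (hα : DifferentiableAt ℝ (inChart α p) (extChartAt 𝓘(ℝ, E) p p)) (v w : E) :
    (mextDeriv α p).toAlternatingMap ![v, w] =
      dform (inChart α p) (extChartAt 𝓘(ℝ, E) p p) v w := by
  have : IsManifold 𝓘(ℝ, E) 1 M := .of_le (n := ∞) (by simp)
  set a := inChart α p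
  set y₀ := extChartAt 𝓘(ℝ, E) p p
  have hd : DifferentiableAt ℝ (fun y : E ↦ ContinuousAlternatingMap.ofSubsingleton ℝ E ℝ
      (0 : Fin 1) (a y)) y₀ :=
    (ContinuousAlternatingMap.ofSubsingletonLIE (𝕜 := ℝ) (E := E) (F := ℝ)
      (0 : Fin 1)).toContinuousLinearEquiv.differentiableAt.comp y₀ hα
  have happ : ∀ u u' : E, fderiv ℝ (fun y ↦ a y u) y₀ u' = fderiv ℝ a y₀ u' u := fun u u' ↦ by
    have := hα.hasFDerivAt.clm_apply (hasFDerivAt_const u y₀)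
    rw [this.fderiv]
    simp
  have h := extDeriv_apply hd ![v, w]
  rw [Fin.sum_univ_two] at h
  simp only [Fin.val_zero, pow_zero, one_smul, Fin.val_one, pow_one, neg_smul] at h
  have h2 : (mextDeriv α p).toAlternatingMap ![v, w] = extDeriv (fun y : E ↦
      ContinuousAlternatingMap.ofSubsingleton ℝ E ℝ (0 : Fin 1) (a y)) y₀ ![v, w] := by
    have h3 : ((mfderiv 𝓘(ℝ, E) 𝓘(ℝ, E) (extChartAt 𝓘(ℝ, E) p) p : E →L[ℝ] E)) =
        ContinuousLinearMap.id ℝ E := mfderiv_extChartAt_self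
    change (extDeriv (fun y : E ↦ ContinuousAlternatingMap.ofSubsingleton ℝ E ℝ (0 : Fin 1)
      (a y)) y₀).compContinuousLinearMap
        (mfderiv 𝓘(ℝ, E) 𝓘(ℝ, E) (extChartAt 𝓘(ℝ, E) p) p : E →L[ℝ] E) ![v, w] = _
    rw [h3]
    rfl
  rw [h2, h, dform_apply, ← happ w v, ← happ v w]
  rfl

theorem mvfderiv_comp_extChartAt {f : E → ℝ} {p q : M} (hq : q ∈ (chartAt E p).source)
    (hf : DifferentiableAt ℝ f (extChartAt 𝓘(ℝ, E) p q)) (v : TangentSpace 𝓘(ℝ, E) q) :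
    mvfderiv 𝓘(ℝ, E) (fun m : M ↦ f (extChartAt 𝓘(ℝ, E) p m)) q v =
      fderiv ℝ f (extChartAt 𝓘(ℝ, E) p q)
        (mfderiv 𝓘(ℝ, E) 𝓘(ℝ, E) (extChartAt 𝓘(ℝ, E) p) q v) := by
  have : IsManifold 𝓘(ℝ, E) 1 M := .of_le (n := ∞) (by simp)
  have h1 := hf.hasFDerivAt.hasMFDerivAt.comp q
    (mdifferentiableAt_extChartAt (I := 𝓘(ℝ, E)) hq).hasMFDerivAt
  exact DFunLike.congr_fun h1.mfderiv v

end Chart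

/-! ### Darboux coordinates -/

section Coordinates

/-- The functions `x`, `y`, `z` in the order `(x₁, …, xₙ, y₁, …, yₙ, z)`. -/
def coords {n : ℕ} {X : Type*} (x y : Fin n → X) (z : X) (i : Fin (2 * n + 1)) : X :=
  if h : i.1 < n then x ⟨i, h⟩ else if h' : i.1 < 2 * n then y ⟨i - n, by omega⟩ else z

@[simp]
theorem coords_xIdx {n : ℕ} {X : Type*} (x y : Fin n → X) (z : X) (j : Fin n) :
    coords x y z (xIdx j) = x j := by
  simp [coords, xIdx]

@[simp]
theorem coords_yIdx {n : ℕ} {X : Type*} (x y : Fin n → X) (z : X) (j : Fin n) :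
    coords x y z (yIdx j) = y j := by
  have : n + j.1 < 2 * n := by omega
  simp [coords, yIdx, this]

@[simp]
theorem coords_zIdx {n : ℕ} {X : Type*} (x y : Fin n → X) (z : X) : coords x y z (zIdx n) = z := by
  have : ¬ 2 * n < n := by omega
  simp [coords, zIdx, this]

theorem forall_coords {n : ℕ} {X : Type*} {x y : Fin n → X} {z : X} {P : X → Prop}
    (hx : ∀ j, P (x j)) (hy : ∀ j, P (y j)) (hz : P z) (i : Fin (2 * n + 1)) :
    P (coords x y z i) := by
  unfold coords
  split_ifs
  exacts [hx _, hy _, hz]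

variable {E : Type*} [NormedAddCommGroup E] [NormedSpace ℝ E]

/-- If `α = dz + ∑ xⱼ dyⱼ`, then `dα = ∑ dxⱼ ∧ dyⱼ`. -/
theorem dform_eq_sum {n : ℕ} {α : E → E →L[ℝ] ℝ} {p : E} {x y : Fin n → E → ℝ} {z : E → ℝ}
    (hx : ∀ j, SmoothNear (x j) p) (hy : ∀ j, SmoothNear (y j) p) (hz : SmoothNear z p)
    (h : ∀ᶠ q in 𝓝 p, ∀ v, α q v = fderiv ℝ z q v + ∑ j, x j q * fderiv ℝ (y j) q v) (v w : E) :
    dform α p v w = ∑ j, (fderiv ℝ (x j) p v * fderiv ℝ (y j) p w -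
      fderiv ℝ (x j) p w * fderiv ℝ (y j) p v) := by
  have hsymm : ∀ {f : E → ℝ}, SmoothNear f p → ∀ v w,
      fderiv ℝ (fderiv ℝ f) p v w = fderiv ℝ (fderiv ℝ f) p w v := fun hf v w ↦ by
    have h1 : IsSymmSndFDerivAt ℝ _ p := hf.contDiffAt.isSymmSndFDerivAt (by
      rw [minSmoothness_of_isRCLikeNormedField]
      exact WithTop.coe_le_coe.2 (le_top (a := (2 : ℕ∞))))
    exact h1.eq v w
  have h1 : HasFDerivAt (fun q ↦ fderiv ℝ z q + ∑ j, x j q • fderiv ℝ (y j) q) _ p :=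
    hz.fderiv_right.differentiableAt.hasFDerivAt.add
      (HasFDerivAt.fun_sum fun j _ ↦ (hx j).differentiableAt.hasFDerivAt.smul
        (hy j).fderiv_right.differentiableAt.hasFDerivAt)
  have h2 : α =ᶠ[𝓝 p] fun q ↦ fderiv ℝ z q + ∑ j, x j q • fderiv ℝ (y j) q := by
    filter_upwards [h] with q hq
    ext v
    simp [hq v]
  have h3 := h1.congr_of_eventuallyEq h2
  rw [dform_apply, h3.fderiv]
  simp only [add_apply, sum_apply, smul_apply, ContinuousLinearMap.smulRight_apply, smul_eq_mul]
  rw [hsymm hz v w, add_sub_add_left_eq_sub, ← Finset.sum_sub_distrib]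
  refine Finset.sum_congr rfl fun j _ ↦ ?_
  rw [hsymm (hy j) v w]
  ring

/-- A normal form of a nondegenerate one-form provides a system of coordinates. -/
theorem exists_chart_of_normalForm {n : ℕ}
    {α : EuclideanSpace ℝ (Fin (2 * n + 1)) → EuclideanSpace ℝ (Fin (2 * n + 1)) →L[ℝ] ℝ}
    {p : EuclideanSpace ℝ (Fin (2 * n + 1))}
    (hnd : ∀ v, α p v = 0 → (∀ w, dform α p v w = 0) → v = 0)
    {x y : Fin n → EuclideanSpace ℝ (Fin (2 * n + 1)) → ℝ}
    {z : EuclideanSpace ℝ (Fin (2 * n + 1)) → ℝ}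
    (hx : ∀ j, SmoothNear (x j) p) (hy : ∀ j, SmoothNear (y j) p) (hz : SmoothNear z p)
    (h : ∀ᶠ q in 𝓝 p, ∀ v, α q v = fderiv ℝ z q v + ∑ j, x j q * fderiv ℝ (y j) q v) :
    ∃ e : OpenPartialHomeomorph (EuclideanSpace ℝ (Fin (2 * n + 1)))
        (EuclideanSpace ℝ (Fin (2 * n + 1))), p ∈ e.source ∧
      (∀ q i, e q i = coords x y z i q) ∧ (∀ q ∈ e.source, ContDiffAt ℝ ∞ e q) ∧
      ∀ q ∈ e.target, ContDiffAt ℝ ∞ e.symm q := by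
  let G : EuclideanSpace ℝ (Fin (2 * n + 1)) → EuclideanSpace ℝ (Fin (2 * n + 1)) :=
    fun q ↦ WithLp.toLp 2 fun i ↦ coords x y z i q
  have hc : ∀ i, SmoothNear (coords x y z i) p :=
    forall_coords (P := fun f ↦ SmoothNear f p) hx hy hz
  have hG : SmoothNear G p := by
    filter_upwards [eventually_all.2 hc] with q hq
    exact contDiffAt_euclidean.2 hq
  -- A vector killed by all coordinate differentials is killed by α and by dα.
  have hinj : ∀ v, fderiv ℝ G p v = 0 → v = 0 := by
    intro v hv
    have hci : ∀ i, fderiv ℝ (coords x y z i) p v = 0 := fun i ↦ by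
      have h1 : HasFDerivAt (fun q ↦ G q i) _ p :=
        (EuclideanSpace.proj i :
          EuclideanSpace ℝ (Fin (2 * n + 1)) →L[ℝ] ℝ).hasFDerivAt.comp p
          hG.differentiableAt.hasFDerivAt
      have h2 : fderiv ℝ (coords x y z i) p v = (fderiv ℝ G p v) i :=
        DFunLike.congr_fun h1.fderiv v
      rw [h2, hv]; rfl
    have hxv : ∀ j, fderiv ℝ (x j) p v = 0 := fun j ↦ by simpa using hci (xIdx j)
    have hyv : ∀ j, fderiv ℝ (y j) p v = 0 := fun j ↦ by simpa using hci (yIdx j)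
    have hzv : fderiv ℝ z p v = 0 := by simpa using hci (zIdx n)
    refine hnd v ?_ fun w ↦ ?_
    · rw [h.self_of_nhds v]; simp [hyv, hzv]
    · rw [dform_eq_sum hx hy hz h]; simp [hxv, hyv]
  let A := (LinearEquiv.ofInjectiveEndo (fderiv ℝ G p).toLinearMap
    (LinearMap.ker_eq_bot.1 (LinearMap.ker_eq_bot'.2 hinj))).toContinuousLinearEquiv
  obtain ⟨e, hp, heG, hes, het⟩ := hG.exists_openPartialHomeomorph A
    hG.differentiableAt.hasFDerivAt
  have heG' : (e : _ → _) = G := funext heG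
  exact ⟨e, hp, fun q i ↦ by rw [heG], fun q hq ↦ heG' ▸ hes q hq, het⟩

end Coordinates

end ContactDarboux

end

theorem mainTheorem4 (n : ℕ) {M : Type*} [TopologicalSpace M]
    [ChartedSpace (EuclideanSpace ℝ (Fin (2 * n + 1))) M] [IsManifold (𝓡 (2 * n + 1)) ∞ M]
    (α : ∀ q : M, TangentSpace (𝓡 (2 * n + 1)) q →L[ℝ] ℝ)
    (hα : ContactDarboux.IsContactForm n α) (p : M) :
    ∃ e ∈ IsManifold.maximalAtlas (𝓡 (2 * n + 1)) ∞ M, p ∈ e.source ∧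
      ∀ q ∈ e.source,
        α q = mvfderiv (𝓡 (2 * n + 1)) (fun m : M ↦ e m (ContactDarboux.zIdx n)) q
          + ∑ j : Fin n, e q (ContactDarboux.xIdx j) •
              mvfderiv (𝓡 (2 * n + 1)) (fun m : M ↦ e m (ContactDarboux.yIdx j)) q := by
  open ContactDarboux Filter Topology in
  let φ := extChartAt (𝓡 (2 * n + 1)) p
  let a := inChart α p
  have hdim : Module.finrank ℝ (EuclideanSpace ℝ (Fin (2 * n + 1))) = 2 * n + 1 := by simp
  have ha : SmoothNear a (φ p) := by
    have ho : IsOpen φ.target := isOpen_extChartAt_target p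
    filter_upwards [ho.mem_nhds (mem_extChartAt_target p)] with y hy
    exact (hα.smooth.contDiffOn_inChart p).contDiffAt (ho.mem_nhds hy)
  have hnd : ∀ v, a (φ p) v = 0 → (∀ w, dform a (φ p) v w = 0) → v = 0 := fun v h1 h2 ↦
    eq_zero_of_wedge_ne_zero (V := EuclideanSpace ℝ (Fin (2 * n + 1))) hdim
      (hα.wedge_ne_zero p) (v := v)
      ((inChart_self α p v).symm.trans h1)
      fun w ↦ (mextDeriv_apply ha.differentiableAt v w).trans (h2 w)
  obtain ⟨x, y, z, hx, hy, hz, h⟩ := hasDarbouxForm_of_contact hdim ha hnd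
  obtain ⟨g, hpg, hgc, hgs, hgt⟩ := exists_chart_of_normalForm hnd hx hy hz h
  -- The normal form is only known as a germ, so the chart is shrunk to an open set where it holds
  -- and z, yⱼ are differentiable.
  obtain ⟨U, hU, hUo, hpU⟩ := eventually_nhds_iff.1 (h.and (hz.and (eventually_all.2 hy)))
  let c := chartAt (EuclideanSpace ℝ (Fin (2 * n + 1))) p
  have hφc : ∀ m, φ m = c m := fun m ↦ by simp [φ, c]
  let g' := g.restr U
  have hg's : g'.source = g.source ∩ U := by rw [g.restr_source, hUo.interior_eq]
  refine ⟨c.trans g', ?_, ?_, fun q hq ↦ ?_⟩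
  · rw [IsManifold.mem_maximalAtlas_iff_contMDiffOn]
    have hc := IsManifold.chart_mem_maximalAtlas (I := 𝓡 (2 * n + 1)) (n := ∞) p
    have hg1 : ContMDiffOn (𝓡 (2 * n + 1)) (𝓡 (2 * n + 1)) ∞ g' g'.source := by
      rw [contMDiffOn_iff_contDiffOn]
      exact fun q hq ↦ (hgs q (hg's ▸ hq).1).contDiffWithinAt
    have hg2 : ContMDiffOn (𝓡 (2 * n + 1)) (𝓡 (2 * n + 1)) ∞ g'.symm g'.target := by
      rw [contMDiffOn_iff_contDiffOn]
      exact fun q hq ↦ (hgt q hq.1).contDiffWithinAt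
    constructor
    · exact hg1.comp ((contMDiffOn_of_mem_maximalAtlas hc).mono fun q hq ↦ hq.1) fun q hq ↦ hq.2
    · exact (contMDiffOn_symm_of_mem_maximalAtlas hc).comp (hg2.mono fun q hq ↦ hq.1)
        fun q hq ↦ hq.2
  · refine ⟨mem_chart_source _ p, ?_⟩
    change c p ∈ g'.source
    rw [hg's, ← hφc]
    exact ⟨hpg, hpU⟩
  · have hqc : q ∈ c.source := hq.1
    have hqU : φ q ∈ U := by
      rw [hφc]
      exact (hg's ▸ (show c q ∈ g'.source from hq.2)).2
    obtain ⟨h1, h2, h3⟩ := hU _ hqU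
    have he : ∀ m i, (c.trans g') m i = coords x y z i (φ m) := fun m i ↦ by
      rw [hφc, ← hgc]; rfl
    have hmv : ∀ f : EuclideanSpace ℝ (Fin (2 * n + 1)) → ℝ, ContDiffAt ℝ ∞ f (φ q) → ∀ v,
        mvfderiv (𝓡 (2 * n + 1)) (fun m : M ↦ f (φ m)) q v = fderiv ℝ f (φ q)
          (mfderiv (𝓡 (2 * n + 1)) (𝓡 (2 * n + 1)) φ q v) := fun f hf ↦
      mvfderiv_comp_extChartAt hqc (hf.differentiableAt (by simp))
    ext v
    simp only [he, coords_xIdx, coords_yIdx, coords_zIdx, add_apply, sum_apply, smul_apply,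
      hmv z h2, hmv _ (h3 _), smul_eq_mul]
    exact (eq_inChart_comp α hqc v).trans (h1 _)
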